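/- **Setting.** Let $N\ge 1$ be an integer, $0<k<1$ and $\beta<0$. Let $\mathrm{sn},\mathrm{cn},\mathrm{dn}$ be the Jacobi elliptic functions of modulus $k$, let $K=\int_0^{\pi/2}(1-k^2\sin^2\theta)^{-1/2}\,d\theta$, $E(z,k)=\int_0^z \mathrm{dn}^2 y\,dy$ and $E=E(K,k)$, and put $B=KN/\pi$. On the interval $[-NK,NK)$ let $L^2_{\rm per}$ be the complex space of square integrable functions with $\langle u,v\rangle=\int_{-NK}^{NK}u\,\overline v\,dz$, and let $H^m_{\rm per}$ be the subspace of those $f$ with $\sum_{j\in\mathbb Z}|c_j|^2(1+|j|^2+\cdots+|j|^{2m})<\infty$, where the $c_j$ are the Fourier coefficients of $f$ on this interval. Put $$L_-=-\frac{d^2}{dz^2}-2\,\mathrm{dn}^2z-k^2+2,\qquad L_+=-\frac{d^2}{dz^2}-6\,\mathrm{dn}^2z-k^2+2,$$ both with domain $H^2_{\rm per}$, and let $$\mathbf L=-\frac{\beta}{2}B^2\begin{pmatrix}0&L_-\\-L_+&0\end{pmatrix}$$ on $L^2_{\rm per}\times L^2_{\rm per}$ with domain $H^2_{\rm per}\times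 H^2_{\rm per}$. Let $\mathbf L^\dagger$ be its Hilbert space adjoint, let $\ker_g(\mathbf L^\dagger)=\bigcup_{m\ge1}\ker((\mathbf L^\dagger)^m)$, and let $\mathcal M=(H^1_{\rm per}\times H^1_{\rm per})\cap(\ker_g(\mathbf L^\dagger))^\perp$. Finally, put $$\phi(z)=(K\,E(z,k)-E\,z)\,\mathrm{dn}\,z-k^2K\,\mathrm{sn}\,z\,\mathrm{cn}\,z,$$ $$\varphi(z)=k^2\,\mathrm{cn}\,z\,\mathrm{sn}\,z\,(K\,E(z,k)-E\,z)+(E-K)\,\mathrm{dn}\,z+k^2K\,\mathrm{cn}^2z\,\mathrm{dn}\,z.$$ **Proposition.** One has $$\ker_g(\mathbf L^\dagger)=\ker((\mathbf L^\dagger)^2)=\mathrm{span}\{(\mathrm{dn}\,z,0),\ (0,\mathrm{sn}\,z\,\mathrm{cn}\,z),\ (\phi,0),\ (0,\varphi)\}.$$ Moreover, if $f,g\in H^1_{\rm per}$ satisfy $\langle f,\mathrm{dn}\,z\rangle=\langle f,\phi\rangle=0$ and $\langle g,\mathrm{sn}\,z\,\mathrm{cn}\,z\rangle=\langle g,\varphi\rangle=0$,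 then $(f,g)\in\mathcal M$. -/

import Mathlib

open MeasureTheory AddCircle
open scoped ComplexConjugate

namespace DnWave

noncomputable section

/-! ### Jacobi elliptic functions and elliptic integrals of modulus `k`, for `0 < k < 1` -/

/-- The elliptic moduli `0 < k < 1`. -/
abbrev Modulus : Type := Set.Ioo (0 : ℝ) 1

/-- The integrand `1 / √(1 - k² sin² θ)` of the elliptic integral of the first kind. -/
def integrandF (k : Modulus) (θ : ℝ) : ℝ := 1 / √(1 - (k : ℝ) ^ 2 * Real.sin θ ^ 2)

/-- The incomplete elliptic integral of the first kind `∫₀^φ dθ / √(1 - k² sin² θ)`. -/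
def incF (k : Modulus) (φ : ℝ) : ℝ := ∫ θ in (0 : ℝ)..φ, integrandF k θ

/-- The complete elliptic integral of the first kind. -/
def ellK (k : Modulus) : ℝ := incF k (Real.pi / 2)

theorem radicand_pos (k : Modulus) (θ : ℝ) : 0 < 1 - (k : ℝ) ^ 2 * Real.sin θ ^ 2 := by
  have h0 := k.2.1
  have h1 := k.2.2
  have h2 := Real.sin_sq_le_one θ
  have h3 : (k : ℝ) ^ 2 < 1 := by nlinarith
  nlinarith [sq_nonneg (k : ℝ), sq_nonneg (Real.sin θ)]

theorem continuous_integrandF (k : Modulus) : Continuous (integrandF k) := by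
  unfold integrandF
  refine continuous_const.div (by fun_prop) fun θ => ?_
  exact (Real.sqrt_pos.2 (radicand_pos k θ)).ne'

theorem one_le_integrandF (k : Modulus) (θ : ℝ) : 1 ≤ integrandF k θ := by
  unfold integrandF
  rw [le_div_iff₀ (Real.sqrt_pos.2 (radicand_pos k θ)), one_mul, Real.sqrt_le_one]
  nlinarith [mul_nonneg (sq_nonneg (k : ℝ)) (sq_nonneg (Real.sin θ))]

theorem sub_le_incF_sub (k : Modulus) {a b : ℝ} (hab : a ≤ b) : b - a ≤ incF k b - incF k a := by
  have hi := fun a b : ℝ => (continuous_integrandF k).intervalIntegrable (μ := volume) a b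
  have h : incF k b - incF k a = ∫ θ in a..b, integrandF k θ :=
    intervalIntegral.integral_interval_sub_left (hi 0 b) (hi 0 a)
  rw [h]
  have h2 := intervalIntegral.integral_mono_on hab
    ((continuous_const (y := (1 : ℝ))).intervalIntegrable (μ := volume) a b) (hi a b)
    (fun θ _ => one_le_integrandF k θ)
  simpa using h2

theorem strictMono_incF (k : Modulus) : StrictMono (incF k) := fun a b hab => by
  have := sub_le_incF_sub k hab.le
  linarith

theorem continuous_incF (k : Modulus) : Continuous (incF k) :=
  intervalIntegral.continuous_primitive
    (fun a b => (continuous_integrandF k).intervalIntegrable a b) 0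

theorem incF_zero (k : Modulus) : incF k 0 = 0 := by simp [incF]

theorem surjective_incF (k : Modulus) : Function.Surjective (incF k) := by
  refine (continuous_incF k).surjective ?_ ?_
  · refine Filter.tendsto_atTop_mono' _ ?_ Filter.tendsto_id
    filter_upwards [Filter.eventually_ge_atTop (0 : ℝ)] with x hx
    have := sub_le_incF_sub k hx
    simpa [incF_zero] using this
  · refine Filter.tendsto_atBot_mono' _ ?_ Filter.tendsto_id
    filter_upwards [Filter.eventually_le_atBot (0 : ℝ)] with x hx
    have := sub_le_incF_sub k hx
    simpa [incF_zero] using this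

/-- The incomplete elliptic integral of the first kind as an increasing bijection of `ℝ`. -/
def incFIso (k : Modulus) : ℝ ≃o ℝ :=
  (strictMono_incF k).orderIsoOfSurjective (incF k) (surjective_incF k)

/-- The Jacobi amplitude: the inverse of the incomplete elliptic integral of the first kind. -/
def am (k : Modulus) (z : ℝ) : ℝ := (incFIso k).symm z

/-- The Jacobi elliptic function `sn (z | k)`. -/
def sn (k : Modulus) (z : ℝ) : ℝ := Real.sin (am k z)

/-- The Jacobi elliptic function `cn (z | k)`. -/
def cn (k : Modulus) (z : ℝ) : ℝ := Real.cos (am k z)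

/-- The Jacobi elliptic function `dn (z | k)`. -/
def dn (k : Modulus) (z : ℝ) : ℝ := √(1 - (k : ℝ) ^ 2 * sn k z ^ 2)

/-- The incomplete elliptic integral of the second kind `E(z, k) = ∫₀^z dn² y dy`. -/
def incE (k : Modulus) (z : ℝ) : ℝ := ∫ y in (0 : ℝ)..z, dn k y ^ 2

/-- The complete elliptic integral of the second kind `E(k) = E(K(k), k)`. -/
def ellE (k : Modulus) : ℝ := incE k (ellK k)

/-- `φ(z) = (K(k) E(z,k) - E(k) z) dn z - k² K(k) sn z cn z`. -/
def phi (k : Modulus) (z : ℝ) : ℝ :=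
  (ellK k * incE k z - ellE k * z) * dn k z - (k : ℝ) ^ 2 * ellK k * (sn k z * cn k z)

/-- `ϕ(z) = k² cn z sn z (K(k) E(z,k) - E(k) z) + (E(k) - K(k)) dn z + k² K(k) cn² z dn z`. -/
def varphi (k : Modulus) (z : ℝ) : ℝ :=
  (k : ℝ) ^ 2 * (cn k z * sn k z) * (ellK k * incE k z - ellE k * z)
    + (ellE k - ellK k) * dn k z + (k : ℝ) ^ 2 * ellK k * (cn k z ^ 2 * dn k z)

theorem continuous_am (k : Modulus) : Continuous (am k) := (incFIso k).symm.continuous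

theorem continuous_sn (k : Modulus) : Continuous (sn k) :=
  Real.continuous_sin.comp (continuous_am k)

theorem continuous_cn (k : Modulus) : Continuous (cn k) :=
  Real.continuous_cos.comp (continuous_am k)

theorem continuous_dn (k : Modulus) : Continuous (dn k) := by
  have := continuous_sn k
  unfold dn
  fun_prop

theorem continuous_incE (k : Modulus) : Continuous (incE k) := by
  have := continuous_dn k
  exact intervalIntegral.continuous_primitive
    (fun a b => (this.pow 2).intervalIntegrable a b) 0

theorem continuous_sn_mul_cn (k : Modulus) : Continuous (fun z => sn k z * cn k z) :=
  (continuous_sn k).mul (continuous_cn k)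

theorem continuous_phi (k : Modulus) : Continuous (phi k) := by
  have h1 := continuous_sn k
  have h2 := continuous_cn k
  have h3 := continuous_dn k
  have h4 := continuous_incE k
  unfold phi
  fun_prop

theorem continuous_varphi (k : Modulus) : Continuous (varphi k) := by
  have h1 := continuous_sn k
  have h2 := continuous_cn k
  have h3 := continuous_dn k
  have h4 := continuous_incE k
  unfold varphi
  fun_prop

theorem ellK_pos (k : Modulus) : 0 < ellK k := by
  have h := strictMono_incF k (a := 0) (b := Real.pi / 2) (by positivity)
  rwa [incF_zero] at h

/-! ### Periodic function spaces on `[-N K(k), N K(k))` -/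

/-- The length `2 N K(k)` of the interval `[-N K(k), N K(k))`. -/
def len (N : ℕ+) (k : Modulus) : ℝ := 2 * (N : ℝ) * ellK k

instance len_pos (N : ℕ+) (k : Modulus) : Fact (0 < len N k) :=
  ⟨mul_pos (mul_pos two_pos (Nat.cast_pos.2 N.pos)) (ellK_pos k)⟩

/-- The interval `[-N K(k), N K(k))` with its end points identified. -/
abbrev Circ (N : ℕ+) (k : Modulus) : Type := AddCircle (len N k)

/-- The complex Hilbert space `L²_per[-N K(k), N K(k))`. Its inner product is
`(2 N K(k))⁻¹ ∫ conj (u z) * v z dz` over `[-N K(k), N K(k))`. -/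
abbrev L2 (N : ℕ+) (k : Modulus) : Type := Lp ℂ 2 (haarAddCircle (T := len N k))

/-- The function on the circle that agrees with `h` on `[-N K(k), N K(k))`. -/
def onCirc (N : ℕ+) (k : Modulus) (h : ℝ → ℝ) : Circ N k → ℂ :=
  fun x => ((liftIco (len N k) (-(N * ellK k)) h x : ℝ) : ℂ)

theorem measurable_onCirc (N : ℕ+) (k : Modulus) {h : ℝ → ℝ} (hc : Continuous h) :
    Measurable (onCirc N k h) := by
  refine Complex.measurable_ofReal.comp ?_
  exact (hc.measurable.comp measurable_subtype_coe).comp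
    (measurableEquivIco (len N k) (-(N * ellK k))).measurable

theorem exists_bound_onCirc (N : ℕ+) (k : Modulus) {h : ℝ → ℝ} (hc : Continuous h) :
    ∃ C, ∀ x, ‖onCirc N k h x‖ ≤ C := by
  obtain ⟨C, hC⟩ := (isCompact_Icc (a := -(N * ellK k))
    (b := -(N * ellK k) + len N k)).exists_bound_of_continuousOn hc.continuousOn
  refine ⟨C, fun x => ?_⟩
  have hx := (equivIco (len N k) (-(N * ellK k)) x).2
  simpa [onCirc, liftIco] using hC _ (Set.Ico_subset_Icc_self hx)

theorem memLp_onCirc (N : ℕ+) (k : Modulus) {h : ℝ → ℝ} (hc : Continuous h) :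
    MemLp (onCirc N k h) 2 (haarAddCircle (T := len N k)) := by
  obtain ⟨C, hC⟩ := exists_bound_onCirc N k hc
  exact MemLp.of_bound (measurable_onCirc N k hc).aestronglyMeasurable C
    (Filter.Eventually.of_forall hC)

/-- The element of `L²_per[-N K(k), N K(k))` given by a continuous function `h`. -/
def toL2 (N : ℕ+) (k : Modulus) (h : ℝ → ℝ) (hc : Continuous h) : L2 N k :=
  (memLp_onCirc N k hc).toLp (onCirc N k h)

theorem memLp_onCirc_mul (N : ℕ+) (k : Modulus) {h : ℝ → ℝ} (hc : Continuous h) (f : L2 N k) :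
    MemLp (fun x => onCirc N k h x * f x) 2 (haarAddCircle (T := len N k)) := by
  obtain ⟨C, hC⟩ := exists_bound_onCirc N k hc
  refine (Lp.memLp f).of_le_mul (c := C)
    ((measurable_onCirc N k hc).aestronglyMeasurable.mul (Lp.aestronglyMeasurable f))
    (Filter.Eventually.of_forall fun x => ?_)
  rw [norm_mul]
  exact mul_le_mul_of_nonneg_right (hC x) (norm_nonneg _)

/-- Multiplication by a continuous function `h` on `L²_per[-N K(k), N K(k))`. -/
def mulOp (N : ℕ+) (k : Modulus) (h : ℝ → ℝ) (hc : Continuous h) : L2 N k →ₗ[ℂ] L2 N k where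
  toFun f := (memLp_onCirc_mul N k hc f).toLp (fun x => onCirc N k h x * f x)
  map_add' f g := by
    rw [← MemLp.toLp_add, MemLp.toLp_eq_toLp_iff]
    filter_upwards [Lp.coeFn_add f g] with x hx
    rw [Pi.add_apply, hx, Pi.add_apply, mul_add]
  map_smul' c f := by
    rw [RingHom.id_apply, ← MemLp.toLp_const_smul, MemLp.toLp_eq_toLp_iff]
    filter_upwards [Lp.coeFn_smul c f] with x hx
    simp [hx, mul_left_comm]

/-- The `j`-th term `|c_j|² (1 + |j|² + ⋯ + |j|^{2m})` of the squared `H^m_per` norm, where the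
`c_j` are the Fourier coefficients on `[-N K(k), N K(k))`. -/
def sobolevTerm (N : ℕ+) (k : Modulus) (m : ℕ) (f : L2 N k) (j : ℤ) : ℝ :=
  ‖fourierCoeff (f : Circ N k → ℂ) j‖ ^ 2 * ∑ i ∈ Finset.range (m + 1), |(j : ℝ)| ^ (2 * i)

theorem fourierCoeff_L2_add {N : ℕ+} {k : Modulus} (f g : L2 N k) (j : ℤ) :
    fourierCoeff ((f + g : L2 N k) : Circ N k → ℂ) j
      = fourierCoeff (f : Circ N k → ℂ) j + fourierCoeff (g : Circ N k → ℂ) j := by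
  simp only [← fourierBasis_repr, map_add, lp.coeFn_add, Pi.add_apply]

theorem fourierCoeff_L2_smul {N : ℕ+} {k : Modulus} (c : ℂ) (f : L2 N k) (j : ℤ) :
    fourierCoeff ((c • f : L2 N k) : Circ N k → ℂ) j
      = c * fourierCoeff (f : Circ N k → ℂ) j := by
  simp only [← fourierBasis_repr, map_smul, lp.coeFn_smul, Pi.smul_apply, smul_eq_mul]

theorem fourierCoeff_L2_zero {N : ℕ+} {k : Modulus} (j : ℤ) :
    fourierCoeff ((0 : L2 N k) : Circ N k → ℂ) j = 0 := by
  simp only [← fourierBasis_repr, map_zero, lp.coeFn_zero, Pi.zero_apply]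

theorem sobolevTerm_nonneg (N : ℕ+) (k : Modulus) (m : ℕ) (f : L2 N k) (j : ℤ) :
    0 ≤ sobolevTerm N k m f j := by
  unfold sobolevTerm
  positivity

/-- The periodic Sobolev space `H^m_per[-N K(k), N K(k))`: the square integrable functions with
`∑_j |c_j|² (1 + |j|² + ⋯ + |j|^{2m}) < ∞`. -/
def Hper (N : ℕ+) (k : Modulus) (m : ℕ) : Submodule ℂ (L2 N k) where
  carrier := {f | Summable (sobolevTerm N k m f)}
  zero_mem' := by
    have : sobolevTerm N k m 0 = 0 := by
      funext j
      unfold sobolevTerm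
      rw [fourierCoeff_L2_zero]
      simp
    rw [Set.mem_ofPred_eq, this]
    exact summable_zero
  add_mem' {f g} hf hg := by
    refine Summable.of_nonneg_of_le (sobolevTerm_nonneg N k m _) (fun j => ?_)
      ((hf.mul_left 2).add (hg.mul_left 2))
    unfold sobolevTerm
    rw [fourierCoeff_L2_add, ← mul_assoc, ← mul_assoc, ← add_mul]
    refine mul_le_mul_of_nonneg_right ?_ (by positivity)
    have h := norm_add_le (fourierCoeff (f : Circ N k → ℂ) j) (fourierCoeff (g : Circ N k → ℂ) j)
    have h2 := pow_le_pow_left₀ (norm_nonneg _) h 2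
    nlinarith [sq_nonneg (‖fourierCoeff (f : Circ N k → ℂ) j‖
      - ‖fourierCoeff (g : Circ N k → ℂ) j‖)]
  smul_mem' c f hf := by
    have : sobolevTerm N k m (c • f) = fun j => ‖c‖ ^ 2 * sobolevTerm N k m f j := by
      funext j
      unfold sobolevTerm
      rw [fourierCoeff_L2_smul, norm_mul, mul_pow, mul_assoc]
    rw [Set.mem_ofPred_eq, this]
    exact hf.mul_left _

/-- The Fourier coefficients `(2 π i j / (2 N K(k)))² c_j` of the second derivative of `f`. -/
def deriv2Coeff (N : ℕ+) (k : Modulus) (f : L2 N k) (j : ℤ) : ℂ :=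
  (2 * Real.pi * Complex.I * j / len N k) ^ 2 * fourierCoeff (f : Circ N k → ℂ) j

theorem memℓp_deriv2Coeff (N : ℕ+) (k : Modulus) (f : Hper N k 2) :
    Memℓp (deriv2Coeff N k f) 2 := by
  rw [memℓp_gen_iff (by norm_num)]
  have hf : Summable (sobolevTerm N k 2 f) := f.2
  refine Summable.of_nonneg_of_le (fun j => by positivity) (fun j => ?_)
    (hf.mul_left ((2 * Real.pi / len N k) ^ 4))
  have hT : 0 < len N k := (len_pos N k).out
  have e : ‖deriv2Coeff N k f j‖ ^ 2 = (2 * Real.pi / len N k) ^ 4 *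
      (‖fourierCoeff ((f : L2 N k) : Circ N k → ℂ) j‖ ^ 2 * |(j : ℝ)| ^ 4) := by
    simp only [deriv2Coeff, norm_mul, norm_pow, norm_div, Complex.norm_I, Complex.norm_real,
      Complex.norm_ofNat, Complex.norm_intCast, Real.norm_eq_abs, abs_of_pos hT,
      abs_of_pos Real.pi_pos]
    ring
  have e2 : ‖deriv2Coeff N k f j‖ ^ (2 : ENNReal).toReal = ‖deriv2Coeff N k f j‖ ^ 2 := by
    norm_num
  rw [e2, e]
  unfold sobolevTerm
  refine mul_le_mul_of_nonneg_left (mul_le_mul_of_nonneg_left ?_ (by positivity)) (by positivity)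
  simp only [Finset.sum_range_succ, Finset.sum_range_zero]
  have := sq_nonneg |(j : ℝ)|
  norm_num
  positivity

/-- The second derivative `d²/dz² : H²_per → L²_per`. -/
def deriv2 (N : ℕ+) (k : Modulus) : Hper N k 2 →ₗ[ℂ] L2 N k where
  toFun f := fourierBasis.repr.symm ⟨deriv2Coeff N k f, memℓp_deriv2Coeff N k f⟩
  map_add' f g := by
    rw [← map_add]
    congr 1
    ext j
    exact (congrArg _ (fourierCoeff_L2_add (f : L2 N k) (g : L2 N k) j)).trans (mul_add _ _ _)
  map_smul' c f := by
    rw [RingHom.id_apply, ← map_smul]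
    congr 1
    ext j
    simp [deriv2Coeff, fourierCoeff_L2_smul, mul_left_comm]

/-! ### The linearized operator -/

/-- `-d²/dz² - a dn² z - k² + 2` on `H²_per`. -/
def schrodingerOp (N : ℕ+) (k : Modulus) (a : ℝ) : Hper N k 2 →ₗ[ℂ] L2 N k :=
  -deriv2 N k + mulOp N k (fun z => -a * dn k z ^ 2 - (k : ℝ) ^ 2 + 2)
    (((continuous_const.mul ((continuous_dn k).pow 2)).sub continuous_const).add
      continuous_const) ∘ₗ (Hper N k 2).subtype

/-- `L₋ = -d²/dz² - 2 dn² z - k² + 2`. -/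
def Lminus (N : ℕ+) (k : Modulus) : Hper N k 2 →ₗ[ℂ] L2 N k := schrodingerOp N k 2

/-- `L₊ = -d²/dz² - 6 dn² z - k² + 2`. -/
def Lplus (N : ℕ+) (k : Modulus) : Hper N k 2 →ₗ[ℂ] L2 N k := schrodingerOp N k 6

/-- The Hilbert space `L²_per × L²_per` of pairs. -/
abbrev Pairs (N : ℕ+) (k : Modulus) : Type := WithLp 2 (L2 N k × L2 N k)

/-- The pair `(f, g)`. -/
def pair {N : ℕ+} {k : Modulus} (f g : L2 N k) : Pairs N k := WithLp.toLp 2 (f, g)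

/-- The subspace `H^m_per × H^m_per` of pairs. -/
def HperPairs (N : ℕ+) (k : Modulus) (m : ℕ) : Submodule ℂ (Pairs N k) :=
  (Hper N k m).comap (WithLp.fstₗ 2 ℂ (L2 N k) (L2 N k))
    ⊓ (Hper N k m).comap (WithLp.sndₗ 2 ℂ (L2 N k) (L2 N k))

/-- The linearized operator `L = -(β/2) B² [[0, L₋], [-L₊, 0]]` with `B = K(k) N / π`, a densely
defined operator on `L²_per × L²_per` with domain `H²_per × H²_per`. -/
def linOp (β : ℝ) (N : ℕ+) (k : Modulus) : Pairs N k →ₗ.[ℂ] Pairs N k where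
  domain := HperPairs N k 2
  toFun :=
    { toFun := fun p => ((-(β / 2) * (ellK k * N / Real.pi) ^ 2 : ℝ) : ℂ) •
        pair (Lminus N k ⟨(p : Pairs N k).snd, p.2.2⟩) (-Lplus N k ⟨(p : Pairs N k).fst, p.2.1⟩)
      map_add' := fun p q => by
        rw [← smul_add]
        congr 1
        have h1 := map_add (Lminus N k) ⟨(p : Pairs N k).snd, p.2.2⟩ ⟨(q : Pairs N k).snd, q.2.2⟩
        have h2 := map_add (Lplus N k) ⟨(p : Pairs N k).fst, p.2.1⟩ ⟨(q : Pairs N k).fst, q.2.1⟩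
        have h3 : ∀ a b c d : L2 N k, pair a b + pair c d = pair (a + c) (b + d) :=
          fun _ _ _ _ => rfl
        rw [h3, ← h1, ← neg_add, ← h2]
        rfl
      map_smul' := fun c p => by
        rw [RingHom.id_apply, smul_comm]
        congr 1
        have h1 := map_smul (Lminus N k) c ⟨(p : Pairs N k).snd, p.2.2⟩
        have h2 := map_smul (Lplus N k) c ⟨(p : Pairs N k).fst, p.2.1⟩
        have h3 : ∀ a b : L2 N k, c • pair a b = pair (c • a) (c • b) := fun _ _ => rfl
        rw [h3, ← h1, smul_neg, ← h2]
        rfl }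

/-- The Hilbert space adjoint `L†` of the linearized operator. -/
def adjOp (β : ℝ) (N : ℕ+) (k : Modulus) : Pairs N k →ₗ.[ℂ] Pairs N k := (linOp β N k).adjoint

/-- The kernel of the power `A^m` of a partially defined operator `A`: a vector `v` lies in
`ker (A^(m+1))` if it lies in the domain of `A` and `A v` lies in `ker (A^m)`. -/
def kerPow {V : Type*} [AddCommGroup V] [Module ℂ V] (A : V →ₗ.[ℂ] V) : ℕ → Submodule ℂ V
  | 0 => ⊥
  | m + 1 => ((kerPow A m).comap A.toFun).map A.domain.subtype

theorem kerPow_le_succ {V : Type*} [AddCommGroup V] [Module ℂ V] (A : V →ₗ.[ℂ] V) (m : ℕ) :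
    kerPow A m ≤ kerPow A (m + 1) := by
  induction m with
  | zero => exact bot_le
  | succ m ih => exact Submodule.map_mono (Submodule.comap_mono ih)

/-- The generalized kernel `⋃_{m ≥ 1} ker (A^m)`. -/
def genKer {V : Type*} [AddCommGroup V] [Module ℂ V] (A : V →ₗ.[ℂ] V) : Submodule ℂ V where
  carrier := ⋃ m ∈ Set.Ici 1, (kerPow A m : Set V)
  zero_mem' := Set.mem_biUnion (Set.mem_Ici.2 le_rfl) (Submodule.zero_mem _)
  add_mem' {v w} hv hw := by
    simp only [Set.mem_iUnion, Set.mem_Ici, SetLike.mem_coe, exists_prop] at hv hw ⊢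
    obtain ⟨m, hm, hv⟩ := hv
    obtain ⟨n, _, hw⟩ := hw
    have hmono := monotone_nat_of_le_succ (kerPow_le_succ A)
    exact ⟨max m n, le_max_of_le_left hm, Submodule.add_mem _ (hmono (le_max_left m n) hv)
      (hmono (le_max_right m n) hw)⟩
  smul_mem' c v hv := by
    simp only [Set.mem_iUnion, Set.mem_Ici, SetLike.mem_coe, exists_prop] at hv ⊢
    obtain ⟨m, hm, hv⟩ := hv
    exact ⟨m, hm, Submodule.smul_mem _ c hv⟩

/-- The space `M = (H¹_per × H¹_per) ∩ (ker_g (L†))^⊥`. -/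
def spaceM (β : ℝ) (N : ℕ+) (k : Modulus) : Submodule ℂ (Pairs N k) :=
  HperPairs N k 1 ⊓ (genKer (adjOp β N k))ᗮ

/-- `dn z` as an element of `L²_per`. -/
def dnL2 (N : ℕ+) (k : Modulus) : L2 N k := toL2 N k (dn k) (continuous_dn k)

/-- `sn z cn z` as an element of `L²_per`. -/
def snCnL2 (N : ℕ+) (k : Modulus) : L2 N k :=
  toL2 N k (fun z => sn k z * cn k z) (continuous_sn_mul_cn k)

/-- `φ(z)` as an element of `L²_per`. -/
def phiL2 (N : ℕ+) (k : Modulus) : L2 N k := toL2 N k (phi k) (continuous_phi k)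

/-- `ϕ(z)` as an element of `L²_per`. -/
def varphiL2 (N : ℕ+) (k : Modulus) : L2 N k := toL2 N k (varphi k) (continuous_varphi k)

end

end DnWave

namespace DnWave

/-! ### Derivatives and periods of the Jacobi functions -/

/-! With `c = -(β/2) B² > 0`, the adjoint is `c [[0, -L₊], [L₋, 0]]` on `H² × H²`, so the kernels of
its powers are found by solving scalar equations for `L₋` and `L₊`.

Level one: `dn` solves `L₋ u = 0` and `dn'`, a multiple of `sn cn`, solves `L₊ u = 0`. Each equation
has a second solution with a secular term: over the length `T = 2NK` it gains `E T dn`, respectively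
`plusConst T dn'`. These factors are nonzero, so a Wronskian argument (`exists_eq_const_mul`) makes
both periodic kernels one-dimensional.

Level two: `L₋ φ = 2E dn'` and `L₊ ϕ = plusConst · dn`, so `φ` and `ϕ` supply particular solutions,
and everything else at this level differs from their multiples by kernel elements.

Level three adds nothing (`kerPow_three_le`): ranges are orthogonal to kernels by symmetry, `dn ⟂
dn'`, and `⟨dn', φ⟩`, `⟨dn, ϕ⟩` both equal `(E² - (1-k²)K²)/(2K)` in the normalised inner product.
All the nonvanishing comes from `√(1-k²) K < E` (`sqrt_mul_ellK_lt_ellE`).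

Since `H²` is defined by Fourier coefficients, two bridges are needed: kernel elements are classical
solutions (`exists_isC2_of_schrodingerOp_eq_zero`), and weak solutions tested against `H²` lie in
`H²` (`schrodingerOp_eq_of_inner`), which identifies the domain of the adjoint. -/

theorem sn_sq_add_cn_sq (k : Modulus) (z : ℝ) : sn k z ^ 2 + cn k z ^ 2 = 1 :=
  Real.sin_sq_add_cos_sq _

theorem dn_sq (k : Modulus) (z : ℝ) : dn k z ^ 2 = 1 - (k : ℝ) ^ 2 * sn k z ^ 2 :=
  Real.sq_sqrt (radicand_pos k _).le

theorem dn_pos (k : Modulus) (z : ℝ) : 0 < dn k z := Real.sqrt_pos.2 (radicand_pos k _)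

theorem hasDerivAt_incF (k : Modulus) (θ : ℝ) : HasDerivAt (incF k) (integrandF k θ) θ :=
  (continuous_integrandF k).integral_hasStrictDerivAt 0 θ |>.hasDerivAt

theorem hasDerivAt_am (k : Modulus) (z : ℝ) : HasDerivAt (am k) (dn k z) z := by
  have h := HasDerivAt.of_local_left_inverse (f := incF k) (g := am k) (a := z)
    (continuous_am k).continuousAt (hasDerivAt_incF k (am k z))
    (one_pos.trans_le (one_le_integrandF k _)).ne'
    (Filter.Eventually.of_forall fun y => (incFIso k).apply_symm_apply y)
  convert! h using 1
  simp [integrandF, dn, sn]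

theorem hasDerivAt_sn (k : Modulus) (z : ℝ) : HasDerivAt (sn k) (cn k z * dn k z) z :=
  (hasDerivAt_am k z).sin

theorem hasDerivAt_cn (k : Modulus) (z : ℝ) : HasDerivAt (cn k) (-sn k z * dn k z) z :=
  (hasDerivAt_am k z).cos

/-- The derivative `-k² sn z cn z` of `dn z`. -/
noncomputable def dnDeriv (k : Modulus) (z : ℝ) : ℝ := -(k : ℝ) ^ 2 * (sn k z * cn k z)

theorem hasDerivAt_dn (k : Modulus) (z : ℝ) : HasDerivAt (dn k) (dnDeriv k z) z := by
  have h := ((((hasDerivAt_sn k z).pow 2).const_mul ((k : ℝ) ^ 2)).const_sub 1).sqrt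
    (radicand_pos k _).ne'
  refine h.congr_deriv ?_
  have hd := (dn_pos k z).ne'
  change _ / (2 * dn k z) = _
  unfold dnDeriv
  field_simp
  push_cast
  ring

theorem hasDerivAt_dnDeriv (k : Modulus) (z : ℝ) :
    HasDerivAt (dnDeriv k) ((2 - (k : ℝ) ^ 2) * dn k z - 2 * dn k z ^ 3) z := by
  refine (((hasDerivAt_sn k z).mul (hasDerivAt_cn k z)).const_mul (-(k : ℝ) ^ 2)).congr_deriv ?_
  linear_combination (2 * dn k z) * dn_sq k z
    - (k : ℝ) ^ 2 * dn k z * sn_sq_add_cn_sq k z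

/-- The first integral of the equation for `dn`. It eliminates `dn'²` in all later identities, so
that they become polynomial in `dn`. -/
theorem dnDeriv_sq (k : Modulus) (z : ℝ) :
    dnDeriv k z ^ 2 = -dn k z ^ 4 + (2 - (k : ℝ) ^ 2) * dn k z ^ 2 - (1 - (k : ℝ) ^ 2) := by
  have h : dn k z ^ 4 = (1 - (k : ℝ) ^ 2 * sn k z ^ 2) ^ 2 := by rw [← dn_sq]; ring
  rw [h, dn_sq]
  unfold dnDeriv
  linear_combination (k : ℝ) ^ 4 * sn k z ^ 2 * sn_sq_add_cn_sq k z

theorem continuous_dnDeriv (k : Modulus) : Continuous (dnDeriv k) :=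
  continuous_const.mul (continuous_sn_mul_cn k)

theorem incF_add_pi (k : Modulus) (θ : ℝ) : incF k (θ + Real.pi) = incF k θ + 2 * ellK k := by
  have hp : Function.Periodic (integrandF k) Real.pi := fun x => by simp [integrandF]
  have hi := fun a b : ℝ => (continuous_integrandF k).intervalIntegrable (μ := volume) a b
  have h1 : incF k (θ + Real.pi) - incF k θ = ∫ t in θ..θ + Real.pi, integrandF k t :=
    intervalIntegral.integral_interval_sub_left (hi _ _) (hi _ _)
  have h2 := hp.intervalIntegral_add_eq θ (-(Real.pi / 2))
  have h3 : -(Real.pi / 2) + Real.pi = Real.pi / 2 := by ring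
  rw [h3, ← intervalIntegral.integral_add_adjacent_intervals (hi (-(Real.pi / 2)) 0) (hi 0 _)] at h2
  have h4 : ∫ t in -(Real.pi / 2)..0, integrandF k t = ellK k := by
    have := intervalIntegral.integral_comp_neg (a := 0) (b := Real.pi / 2) (integrandF k)
    rw [neg_zero] at this
    rw [← this]
    simp [ellK, incF, integrandF]
  have h5 : ∫ t in 0..Real.pi / 2, integrandF k t = ellK k := rfl
  rw [h4, h5] at h2
  linarith

theorem incF_am (k : Modulus) (z : ℝ) : incF k (am k z) = z := (incFIso k).apply_symm_apply z

theorem am_incF (k : Modulus) (θ : ℝ) : am k (incF k θ) = θ := (incFIso k).symm_apply_apply θ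

theorem am_add (k : Modulus) (z : ℝ) : am k (z + 2 * ellK k) = am k z + Real.pi := by
  rw [← am_incF k (am k z + Real.pi), incF_add_pi, incF_am]

theorem am_zero (k : Modulus) : am k 0 = 0 := by
  simpa [incF_zero] using am_incF k 0

theorem am_ellK (k : Modulus) : am k (ellK k) = Real.pi / 2 := am_incF k _

theorem dn_zero (k : Modulus) : dn k 0 = 1 := by simp [dn, sn, am_zero]

theorem dnDeriv_zero (k : Modulus) : dnDeriv k 0 = 0 := by simp [dnDeriv, sn, am_zero]

theorem dnDeriv_ellK (k : Modulus) : dnDeriv k (ellK k) = 0 := by simp [dnDeriv, cn, am_ellK]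

theorem incE_zero (k : Modulus) : incE k 0 = 0 := by simp [incE]

theorem dn_periodic (k : Modulus) : Function.Periodic (dn k) (2 * ellK k) := fun z => by
  simp [dn, sn, am_add]

theorem dnDeriv_periodic (k : Modulus) : Function.Periodic (dnDeriv k) (2 * ellK k) := fun z => by
  simp [dnDeriv, sn, cn, am_add]

theorem hasDerivAt_incE (k : Modulus) (z : ℝ) : HasDerivAt (incE k) (dn k z ^ 2) z :=
  ((continuous_dn k).pow 2).integral_hasStrictDerivAt 0 z |>.hasDerivAt

theorem am_neg (k : Modulus) (z : ℝ) : am k (-z) = -am k z := by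
  have h : incF k (-am k z) = -incF k (am k z) := by
    have := intervalIntegral.integral_comp_neg (a := 0) (b := am k z) (integrandF k)
    rw [neg_zero] at this
    unfold incF
    rw [intervalIntegral.integral_symm, ← this]
    simp [integrandF]
  rw [← am_incF k (-am k z), h, incF_am]

theorem incE_add (k : Modulus) (z : ℝ) : incE k (z + 2 * ellK k) = incE k z + 2 * ellE k := by
  have hi : ∀ a b, IntervalIntegrable (fun y => dn k y ^ 2) volume a b :=
    fun a b => ((continuous_dn k).pow 2).intervalIntegrable a b
  have hp : Function.Periodic (fun y => dn k y ^ 2) (2 * ellK k) := fun x => by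
    simp only [dn_periodic k x]
  have h1 : incE k (z + 2 * ellK k) - incE k z = ∫ t in z..z + 2 * ellK k, dn k t ^ 2 :=
    intervalIntegral.integral_interval_sub_left (hi _ _) (hi _ _)
  have h2 := hp.intervalIntegral_add_eq z (-ellK k)
  have h3 : -ellK k + 2 * ellK k = ellK k := by ring
  rw [h3, ← intervalIntegral.integral_add_adjacent_intervals (hi (-ellK k) 0) (hi 0 _)] at h2
  have h4 : ∫ t in -ellK k..0, dn k t ^ 2 = ellE k := by
    have := intervalIntegral.integral_comp_neg (a := 0) (b := ellK k) (fun y => dn k y ^ 2)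
    rw [neg_zero] at this
    rw [← this]
    simp [ellE, incE, dn, sn, am_neg]
  have h5 : ∫ t in 0..ellK k, dn k t ^ 2 = ellE k := rfl
  rw [h4, h5] at h2
  linarith

/-- The periodic function `K E(z) - E z`. -/
noncomputable def zetaFun (k : Modulus) (z : ℝ) : ℝ := ellK k * incE k z - ellE k * z

theorem zetaFun_periodic (k : Modulus) : Function.Periodic (zetaFun k) (2 * ellK k) := fun z => by
  simp only [zetaFun, incE_add]
  ring

theorem zetaFun_zero (k : Modulus) : zetaFun k 0 = 0 := by simp [zetaFun, incE_zero]

theorem hasDerivAt_zetaFun (k : Modulus) (z : ℝ) :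
    HasDerivAt (zetaFun k) (ellK k * dn k z ^ 2 - ellE k) z := by
  refine (((hasDerivAt_incE k z).const_mul (ellK k)).sub
    ((hasDerivAt_id z).const_mul (ellE k))).congr_deriv ?_
  simp

theorem phi_eq (k : Modulus) (z : ℝ) :
    phi k z = zetaFun k z * dn k z + ellK k * dnDeriv k z := by
  simp only [phi, zetaFun, dnDeriv]
  ring

theorem varphi_eq (k : Modulus) (z : ℝ) :
    varphi k z = -(zetaFun k z * dnDeriv k z) + ellK k * dn k z ^ 3
      + (ellE k - (2 - (k : ℝ) ^ 2) * ellK k) * dn k z := by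
  simp only [varphi, zetaFun, dnDeriv]
  linear_combination (k : ℝ) ^ 2 * ellK k * dn k z * sn_sq_add_cn_sq k z
    - ellK k * dn k z * dn_sq k z

theorem phi_periodic (k : Modulus) : Function.Periodic (phi k) (2 * ellK k) := fun z => by
  simp only [phi_eq, zetaFun_periodic k z, dn_periodic k z, dnDeriv_periodic k z]

theorem varphi_periodic (k : Modulus) : Function.Periodic (varphi k) (2 * ellK k) := fun z => by
  simp only [varphi_eq, zetaFun_periodic k z, dn_periodic k z, dnDeriv_periodic k z]

theorem periodic_len {α : Type*} (N : ℕ+) (k : Modulus) {f : ℝ → α}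
    (hf : Function.Periodic f (2 * ellK k)) : Function.Periodic f (len N k) := by
  have := hf.nat_mul N
  rwa [show ((N : ℕ) : ℝ) * (2 * ellK k) = len N k by unfold len; ring] at this

/-! ### Inequalities between `E` and `K`. -/

/-- The complementary modulus is less than `E / K`. -/
theorem sqrt_mul_ellK_lt_ellE (k : Modulus) : √(1 - (k : ℝ) ^ 2) * ellK k < ellE k := by
  have hk0 := k.2.1
  have hk1 := k.2.2
  have hk2 : (k : ℝ) ^ 2 < 1 := by nlinarith
  set s := √(1 - (k : ℝ) ^ 2) with hs
  have hss : s ^ 2 = 1 - (k : ℝ) ^ 2 := Real.sq_sqrt (by linarith)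
  have hs1 : s < 1 := by
    rw [hs, Real.sqrt_lt' one_pos]
    nlinarith
  -- By the first integral, `(dn'/dn)' = s²/dn² - dn²`, which completes `2 dn² - 2s` to a perfect
  -- square. As `dn'` vanishes at `0` and `K`, integrating over `[0, K]` leaves `2E - 2sK`.
  have hd : ∀ z, HasDerivAt (fun z => 2 * incE k z + dnDeriv k z / dn k z - 2 * s * z)
      ((dn k z - s / dn k z) ^ 2) z := fun z => by
    refine ((((hasDerivAt_incE k z).const_mul 2).add ((hasDerivAt_dnDeriv k z).div
      (hasDerivAt_dn k z) (dn_pos k z).ne')).sub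
      ((hasDerivAt_id z).const_mul (2 * s))).congr_deriv ?_
    have h0 := (dn_pos k z).ne'
    field_simp
    linear_combination -dnDeriv_sq k z - hss
  have hc : Continuous fun z => (dn k z - s / dn k z) ^ 2 := by
    have := continuous_dn k
    exact (this.sub (continuous_const.div this fun z => (dn_pos k z).ne')).pow 2
  have h1 := intervalIntegral.integral_eq_sub_of_hasDerivAt (a := 0) (b := ellK k)
    (fun x _ => hd x) (hc.intervalIntegrable _ _)
  have h2 : 0 < ∫ z in 0..ellK k, (dn k z - s / dn k z) ^ 2 := by
    refine intervalIntegral.integral_pos (ellK_pos k) hc.continuousOn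
      (fun x _ => sq_nonneg _) ⟨0, ⟨le_rfl, (ellK_pos k).le⟩, ?_⟩
    rw [dn_zero, div_one]
    -- Strictness: at `z = 0` the integrand is `(1 - s)²` with `s < 1`.
    exact pow_pos (by linarith) 2
  rw [h1, dnDeriv_ellK, dnDeriv_zero, incE_zero] at h2
  have h3 : incE k (ellK k) = ellE k := rfl
  rw [h3] at h2
  simp only [zero_div, mul_zero, add_zero, sub_zero] at h2
  linarith

theorem ellE_pos (k : Modulus) : 0 < ellE k :=
  (mul_nonneg (Real.sqrt_nonneg _) (ellK_pos k).le).trans_lt (sqrt_mul_ellK_lt_ellE k)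

theorem one_sub_sq_mul_ellK_sq_lt (k : Modulus) :
    (1 - (k : ℝ) ^ 2) * ellK k ^ 2 < ellE k ^ 2 := by
  have hk : (k : ℝ) ^ 2 < 1 := by nlinarith [k.2.1, k.2.2]
  have h := pow_lt_pow_left₀ (sqrt_mul_ellK_lt_ellE k)
    (mul_nonneg (Real.sqrt_nonneg _) (ellK_pos k).le) two_ne_zero
  rwa [mul_pow, Real.sq_sqrt (by linarith)] at h

/-- With `s² = 1 - k²`, so that `2 - k² = 1 + s²`, combine `sK < E` with `2s ≤ 1 + s²`. This is the
sign of `plusConst`. -/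
theorem two_mul_one_sub_sq_mul_ellK_lt (k : Modulus) :
    2 * (1 - (k : ℝ) ^ 2) * ellK k < (2 - (k : ℝ) ^ 2) * ellE k := by
  have hk : (k : ℝ) ^ 2 < 1 := by nlinarith [k.2.1, k.2.2]
  have h := sqrt_mul_ellK_lt_ellE k
  have hs : √(1 - (k : ℝ) ^ 2) ^ 2 = 1 - (k : ℝ) ^ 2 := Real.sq_sqrt (by linarith)
  have hs0 : 0 ≤ √(1 - (k : ℝ) ^ 2) := Real.sqrt_nonneg _
  set s := √(1 - (k : ℝ) ^ 2)
  have h1 : (2 - (k : ℝ) ^ 2) = 1 + s ^ 2 := by linarith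
  rw [h1, ← hs]
  have h2 : (1 + s ^ 2) * (s * ellK k) < (1 + s ^ 2) * ellE k :=
    mul_lt_mul_of_pos_left h (by positivity)
  nlinarith [mul_nonneg (mul_nonneg hs0 (ellK_pos k).le) (sq_nonneg (1 - s))]

/-- The constant `4 (1 - k²) K - 2 (2 - k²) E` in the equation `L₊ ϕ = c dn`. -/
noncomputable def plusConst (k : Modulus) : ℝ :=
  4 * (1 - (k : ℝ) ^ 2) * ellK k - 2 * (2 - (k : ℝ) ^ 2) * ellE k

theorem plusConst_ne_zero (k : Modulus) : plusConst k ≠ 0 := by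
  have := two_mul_one_sub_sq_mul_ellK_lt k
  unfold plusConst
  linarith

/-! ### Solutions of the differential equations -/

/-- `u` is twice differentiable with derivative `u₁` and second derivative `u₂`. -/
def IsC2 {E : Type*} [NormedAddCommGroup E] [NormedSpace ℝ E] (u u₁ u₂ : ℝ → E) : Prop :=
  (∀ z, HasDerivAt u (u₁ z) z) ∧ ∀ z, HasDerivAt u₁ (u₂ z) z

theorem isC2_dn (k : Modulus) :
    IsC2 (dn k) (dnDeriv k) fun z => (2 - (k : ℝ) ^ 2) * dn k z - 2 * dn k z ^ 3 :=
  ⟨hasDerivAt_dn k, hasDerivAt_dnDeriv k⟩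

theorem isC2_dnDeriv (k : Modulus) :
    IsC2 (dnDeriv k) (fun z => (2 - (k : ℝ) ^ 2) * dn k z - 2 * dn k z ^ 3)
      fun z => (2 - (k : ℝ) ^ 2 - 6 * dn k z ^ 2) * dnDeriv k z := by
  refine ⟨hasDerivAt_dnDeriv k, fun z => ?_⟩
  refine (((hasDerivAt_dn k z).const_mul _).sub
    (((hasDerivAt_dn k z).pow 3).const_mul 2)).congr_deriv ?_
  push_cast
  ring

/-- The derivative of `φ`. -/
noncomputable def phiDeriv (k : Modulus) (z : ℝ) : ℝ :=
  zetaFun k z * dnDeriv k z - ellK k * dn k z ^ 3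
    + ((2 - (k : ℝ) ^ 2) * ellK k - ellE k) * dn k z

/-- The inhomogeneity `-2E dn'` arises because `φ` is the nonperiodic homogeneous solution `K (E(z)
dn + dn')` with its secular part `E z dn` removed. -/
theorem isC2_phi (k : Modulus) : IsC2 (phi k) (phiDeriv k) fun z =>
    (2 - (k : ℝ) ^ 2 - 2 * dn k z ^ 2) * phi k z - 2 * ellE k * dnDeriv k z := by
  constructor
  · intro z
    rw [funext (phi_eq k)]
    refine (((hasDerivAt_zetaFun k z).mul (hasDerivAt_dn k z)).add
      ((hasDerivAt_dnDeriv k z).const_mul _)).congr_deriv ?_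
    unfold phiDeriv
    ring
  · intro z
    refine ((((hasDerivAt_zetaFun k z).mul (hasDerivAt_dnDeriv k z)).sub
      (((hasDerivAt_dn k z).pow 3).const_mul _)).add
      ((hasDerivAt_dn k z).const_mul _)).congr_deriv ?_
    simp only [phi_eq]
    push_cast
    ring

/-- The derivative of `ϕ`. -/
noncomputable def varphiDeriv (k : Modulus) (z : ℝ) : ℝ :=
  -(zetaFun k z * ((2 - (k : ℝ) ^ 2) * dn k z - 2 * dn k z ^ 3))
    + 2 * ellK k * dn k z ^ 2 * dnDeriv k z
    + (2 * ellE k - (2 - (k : ℝ) ^ 2) * ellK k) * dnDeriv k z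

theorem isC2_varphi (k : Modulus) : IsC2 (varphi k) (varphiDeriv k) fun z =>
    (2 - (k : ℝ) ^ 2 - 6 * dn k z ^ 2) * varphi k z - plusConst k * dn k z := by
  constructor
  · intro z
    rw [funext (varphi_eq k)]
    refine ((((hasDerivAt_zetaFun k z).mul (hasDerivAt_dnDeriv k z)).neg.add
      (((hasDerivAt_dn k z).pow 3).const_mul _)).add
      ((hasDerivAt_dn k z).const_mul _)).congr_deriv ?_
    unfold varphiDeriv
    push_cast
    ring
  · intro z
    have h := isC2_dnDeriv k
    refine ((((hasDerivAt_zetaFun k z).mul (h.2 z |>.congr_deriv rfl)).neg.add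
      ((((hasDerivAt_dn k z).pow 2).const_mul (2 * ellK k)).mul (h.1 z))).add
      ((h.1 z).const_mul _)).congr_deriv ?_
    simp only [varphi_eq, Pi.pow_apply, plusConst]
    push_cast
    linear_combination (4 * ellK k * dn k z) * dnDeriv_sq k z

/-- The antiderivative of `dn ϕ`. -/
theorem hasDerivAt_dn_mul_varphi (k : Modulus) (z : ℝ) :
    HasDerivAt (fun z => -(zetaFun k z * dn k z ^ 2) / 2 - ellK k / 2 * (dn k z * dnDeriv k z)
      + ellE k / 2 * incE k z - (1 - (k : ℝ) ^ 2) * ellK k / 2 * z) (dn k z * varphi k z) z := by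
  refine ((((((hasDerivAt_zetaFun k z).mul ((hasDerivAt_dn k z).pow 2)).neg.div_const 2).sub
    (((hasDerivAt_dn k z).mul (hasDerivAt_dnDeriv k z)).const_mul _)).add
    ((hasDerivAt_incE k z).const_mul _)).sub ((hasDerivAt_id z).const_mul _)).congr_deriv ?_
  simp only [varphi_eq, Pi.pow_apply]
  push_cast
  linear_combination -(ellK k / 2) * dnDeriv_sq k z

/-- The antiderivative of `dn' φ`. -/
theorem hasDerivAt_dnDeriv_mul_phi (k : Modulus) (z : ℝ) :
    HasDerivAt (fun z => (zetaFun k z * dn k z ^ 2) / 2 + ellK k / 2 * (dn k z * dnDeriv k z)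
      + ellE k / 2 * incE k z - (1 - (k : ℝ) ^ 2) * ellK k / 2 * z) (dnDeriv k z * phi k z) z := by
  refine ((((((hasDerivAt_zetaFun k z).mul ((hasDerivAt_dn k z).pow 2)).div_const 2).add
    (((hasDerivAt_dn k z).mul (hasDerivAt_dnDeriv k z)).const_mul _)).add
    ((hasDerivAt_incE k z).const_mul _)).sub ((hasDerivAt_id z).const_mul _)).congr_deriv ?_
  simp only [phi_eq, Pi.pow_apply]
  push_cast
  linear_combination -(ellK k / 2) * dnDeriv_sq k z

/-! ### Periodic functions as elements of `L²` -/

theorem periodic_ofReal {h : ℝ → ℝ} {T : ℝ} (hp : Function.Periodic h T) :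
    Function.Periodic (fun z => (h z : ℂ)) T := fun z => congrArg Complex.ofReal (hp z)

theorem periodic_mul {u v : ℝ → ℂ} {T : ℝ} (hu : Function.Periodic u T)
    (hv : Function.Periodic v T) : Function.Periodic (fun z => u z * v z) T := hu.mul hv

theorem periodic_sub {u v : ℝ → ℂ} {T : ℝ} (hu : Function.Periodic u T)
    (hv : Function.Periodic v T) : Function.Periodic (fun z => u z - v z) T := hu.sub hv

theorem periodic_const_mul (c : ℂ) {u : ℝ → ℂ} {T : ℝ} (hu : Function.Periodic u T) :
    Function.Periodic (fun z => c * u z) T := fun z => congrArg (c * ·) (hu z)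

section Periodic

variable {N : ℕ+} {k : Modulus}

/-- A continuous periodic function as a continuous function on the circle. -/
noncomputable def circMap (N : ℕ+) (k : Modulus) (u : ℝ → ℂ) (hc : Continuous u)
    (hp : Function.Periodic u (len N k)) : C(Circ N k, ℂ) :=
  ⟨liftIco (len N k) (-(N * ellK k)) u, liftIco_continuous (hp _).symm hc.continuousOn⟩

theorem circMap_coe {u : ℝ → ℂ} (hc : Continuous u) (hp : Function.Periodic u (len N k)) (x : ℝ) :
    circMap N k u hc hp (x : Circ N k) = u x := by
  -- Both functions are bundled into one periodic map so that a single representative in the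
  -- fundamental interval serves for both.
  have h1 : Function.Periodic (fun x : ℝ => (circMap N k u hc hp (x : Circ N k), u x))
      (len N k) := fun z => by simp only [AddCircle.coe_add_period, hp z]
  obtain ⟨y, hy, hxy⟩ := h1.exists_mem_Ico (len_pos N k).out x (-(N * ellK k))
  have h2 : circMap N k u hc hp (y : Circ N k) = u y := liftIco_coe_apply hy
  have h3 := Prod.ext_iff.1 hxy
  exact h3.1.trans (h2.trans h3.2.symm)

/-- A continuous periodic function as an element of `L²`. -/
noncomputable def perL2 (N : ℕ+) (k : Modulus) (u : ℝ → ℂ) (hc : Continuous u)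
    (hp : Function.Periodic u (len N k)) : L2 N k :=
  ContinuousMap.toLp 2 haarAddCircle ℂ (circMap N k u hc hp)

theorem perL2_congr {u v : ℝ → ℂ} (h : u = v) (hc : Continuous u)
    (hp : Function.Periodic u (len N k)) :
    perL2 N k u hc hp = perL2 N k v (h ▸ hc) (h ▸ hp) := by
  subst h
  rfl

theorem perL2_injective {u v : ℝ → ℂ} {hc : Continuous u} {hp : Function.Periodic u (len N k)}
    {hc' : Continuous v} {hp' : Function.Periodic v (len N k)}
    (h : perL2 N k u hc hp = perL2 N k v hc' hp') : u = v := by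
  have h1 : circMap N k u hc hp = circMap N k v hc' hp' :=
    ContinuousMap.toLp_injective haarAddCircle h
  funext x
  rw [← circMap_coe hc hp, ← circMap_coe hc' hp', h1]

/-- Every continuous function on the circle is the descent of its pullback to the line; this turns
sums of Fourier series into periodic functions on `ℝ`. -/
theorem toLp_eq_perL2 (g : C(Circ N k, ℂ)) :
    ContinuousMap.toLp 2 haarAddCircle ℂ g = perL2 N k (fun x => g x)
      (g.continuous.comp (AddCircle.continuous_mk' _))
      (fun x => by simp only [AddCircle.coe_add_period]) := by
  unfold perL2
  congr 1
  ext x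
  induction x using QuotientAddGroup.induction_on with
  | H x =>
    exact (circMap_coe (u := fun x : ℝ => g x) (g.continuous.comp (AddCircle.continuous_mk' _))
      (fun x => by simp only [AddCircle.coe_add_period]) x).symm

theorem toL2_eq_perL2 {h : ℝ → ℝ} (hc : Continuous h) (hp : Function.Periodic h (len N k)) :
    toL2 N k h hc = perL2 N k (fun z => (h z : ℂ)) (Complex.continuous_ofReal.comp hc)
      (periodic_ofReal hp) := rfl

theorem coeFn_perL2 {u : ℝ → ℂ} (hc : Continuous u) (hp : Function.Periodic u (len N k)) :
    perL2 N k u hc hp =ᵐ[haarAddCircle] circMap N k u hc hp :=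
  ContinuousMap.coeFn_toLp haarAddCircle _

theorem mulOp_perL2 {h : ℝ → ℝ} (hh : Continuous h) (hhp : Function.Periodic h (len N k))
    {u : ℝ → ℂ} (hc : Continuous u) (hp : Function.Periodic u (len N k)) :
    mulOp N k h hh (perL2 N k u hc hp) = perL2 N k (fun z => (h z : ℂ) * u z)
      ((Complex.continuous_ofReal.comp hh).mul hc) (periodic_mul (periodic_ofReal hhp) hp) := by
  refine Lp.ext ?_
  refine (MemLp.coeFn_toLp (memLp_onCirc_mul N k hh _)).trans ?_
  filter_upwards [coeFn_perL2 hc hp, coeFn_perL2 (N := N) (k := k)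
    ((Complex.continuous_ofReal.comp hh).mul hc) (periodic_mul (periodic_ofReal hhp) hp)] with x hx hx'
  rw [hx]
  exact hx'.symm

theorem perL2_sub {u v : ℝ → ℂ} (hc : Continuous u) (hp : Function.Periodic u (len N k))
    (hc' : Continuous v) (hp' : Function.Periodic v (len N k)) :
    perL2 N k u hc hp - perL2 N k v hc' hp'
      = perL2 N k (fun z => u z - v z) (hc.sub hc') (periodic_sub hp hp') :=
  (map_sub (ContinuousMap.toLp (E := ℂ) 2 (haarAddCircle (T := len N k)) ℂ) _ _).symm

theorem perL2_smul (c : ℂ) {u : ℝ → ℂ} (hc : Continuous u)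
    (hp : Function.Periodic u (len N k)) :
    c • perL2 N k u hc hp
      = perL2 N k (fun z => c * u z) (continuous_const.mul hc) (periodic_const_mul c hp) :=
  (map_smul (ContinuousMap.toLp (E := ℂ) 2 (haarAddCircle (T := len N k)) ℂ) c _).symm

/-! ### Fourier coefficients of derivatives, and regularity. -/

theorem fourierCoeff_perL2 {u : ℝ → ℂ} (hc : Continuous u) (hp : Function.Periodic u (len N k))
    (n : ℤ) : fourierCoeff (perL2 N k u hc hp : Circ N k → ℂ) n
      = fourierCoeffOn (lt_add_of_pos_right (-(N * ellK k)) (len_pos N k).out) u n :=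
  (fourierCoeff_toLp _ n).trans (fourierCoeff_liftIco_eq u n)

theorem fourierCoeff_perL2_zero {u : ℝ → ℂ} (hc : Continuous u)
    (hp : Function.Periodic u (len N k)) (a : ℝ) :
    fourierCoeff (perL2 N k u hc hp : Circ N k → ℂ) 0
      = (1 / len N k) • ∫ x in a..a + len N k, u x := by
  rw [perL2, fourierCoeff_toLp, fourierCoeff_eq_intervalIntegral _ _ a]
  simp only [circMap_coe]
  simp

/-- Elements of `L²` with the same Fourier coefficients are equal. -/
theorem ext_fourierCoeff {f g : L2 N k} (h : ∀ j, fourierCoeff (f : Circ N k → ℂ) j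
    = fourierCoeff (g : Circ N k → ℂ) j) : f = g := by
  apply fourierBasis.repr.injective
  ext j
  rw [fourierBasis_repr, fourierBasis_repr, h]

/-- Integration by parts with no boundary term, by periodicity. That formula divides by `n`, so `n =
0` is treated separately: a periodic derivative has mean zero. -/
theorem fourierCoeff_deriv {u u₁ : ℝ → ℂ} (hc : Continuous u) (hp : Function.Periodic u (len N k))
    (hc₁ : Continuous u₁) (hp₁ : Function.Periodic u₁ (len N k))
    (hd : ∀ z, HasDerivAt u (u₁ z) z) (n : ℤ) :
    fourierCoeff (perL2 N k u₁ hc₁ hp₁ : Circ N k → ℂ) n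
      = (2 * Real.pi * Complex.I * n / len N k)
        * fourierCoeff (perL2 N k u hc hp : Circ N k → ℂ) n := by
  have hT := (len_pos N k).out
  have hT' : (len N k : ℂ) ≠ 0 := Complex.ofReal_ne_zero.2 hT.ne'
  by_cases hn : n = 0
  · subst hn
    rw [fourierCoeff_perL2_zero hc₁ hp₁ 0, intervalIntegral.integral_eq_sub_of_hasDerivAt
      (fun x _ => hd x) (hc₁.intervalIntegrable _ _), hp 0]
    simp
  · have h := fourierCoeffOn_of_hasDerivAt (lt_add_of_pos_right (-(N * ellK k)) hT) hn
      (fun x _ => hd x) (hc₁.intervalIntegrable _ _)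
    rw [fourierCoeff_perL2 hc hp, fourierCoeff_perL2 hc₁ hp₁, h, hp]
    have hn' : (n : ℂ) ≠ 0 := Int.cast_ne_zero.2 hn
    have hpi : (Real.pi : ℂ) ≠ 0 := Complex.ofReal_ne_zero.2 Real.pi_ne_zero
    have hI := Complex.I_ne_zero
    push_cast
    field_simp
    ring

/-- Membership only needs some `L²` element whose coefficients are those of the second derivative,
because `1 + j² + j⁴ ≤ 2 + 2j⁴`. -/
theorem mem_Hper_two {f w : L2 N k} (h : ∀ j : ℤ, fourierCoeff (w : Circ N k → ℂ) j
    = (2 * Real.pi * Complex.I * j / len N k) ^ 2 * fourierCoeff (f : Circ N k → ℂ) j) :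
    f ∈ Hper N k 2 := by
  have hT := (len_pos N k).out
  have hf := (hasSum_sq_fourierCoeff f).summable
  have hw := (hasSum_sq_fourierCoeff w).summable
  refine Summable.of_nonneg_of_le (sobolevTerm_nonneg N k 2 f) (fun j => ?_)
    ((hf.mul_left 2).add (hw.mul_left (2 * (len N k / (2 * Real.pi)) ^ 4)))
  have hpi := Real.pi_pos
  have e : ‖fourierCoeff (w : Circ N k → ℂ) j‖ ^ 2 = (2 * Real.pi / len N k) ^ 4 *
      (‖fourierCoeff (f : Circ N k → ℂ) j‖ ^ 2 * |(j : ℝ)| ^ 4) := by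
    simp only [h, norm_mul, norm_pow, norm_div, Complex.norm_I, Complex.norm_real,
      Complex.norm_ofNat, Complex.norm_intCast, Real.norm_eq_abs, abs_of_pos hT,
      abs_of_pos Real.pi_pos]
    ring
  have e2 : (len N k / (2 * Real.pi)) ^ 4 * (2 * Real.pi / len N k) ^ 4 = 1 := by
    rw [← mul_pow, div_mul_div_cancel₀ (by positivity), div_self hT.ne', one_pow]
  have e3 : 2 * (len N k / (2 * Real.pi)) ^ 4 * ‖fourierCoeff (w : Circ N k → ℂ) j‖ ^ 2
      = 2 * (‖fourierCoeff (f : Circ N k → ℂ) j‖ ^ 2 * |(j : ℝ)| ^ 4) := by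
    rw [e]
    linear_combination (2 * (‖fourierCoeff (f : Circ N k → ℂ) j‖ ^ 2 * |(j : ℝ)| ^ 4)) * e2
  rw [e3]
  unfold sobolevTerm
  simp only [Finset.sum_range_succ, Finset.sum_range_zero]
  have h0 := sq_nonneg ‖fourierCoeff (f : Circ N k → ℂ) j‖
  rw [mul_zero, pow_zero, mul_one, show 2 * 2 = 4 from rfl]
  nlinarith [mul_nonneg h0 (sq_nonneg (|(j : ℝ)| ^ 2 - 1)), mul_nonneg h0 (sq_nonneg (|(j : ℝ)| ^ 2))]

theorem fourierCoeff_deriv2 (f : Hper N k 2) (j : ℤ) :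
    fourierCoeff (deriv2 N k f : Circ N k → ℂ) j
      = (2 * Real.pi * Complex.I * j / len N k) ^ 2
        * fourierCoeff ((f : L2 N k) : Circ N k → ℂ) j := by
  rw [← fourierBasis_repr]
  change fourierBasis.repr (fourierBasis.repr.symm _) j = _
  rw [LinearIsometryEquiv.apply_symm_apply]
  rfl

theorem fourierCoeff_isC2 {u u₁ u₂ : ℝ → ℂ} (hu : IsC2 u u₁ u₂) (hc : Continuous u)
    (hp : Function.Periodic u (len N k)) (hp₁ : Function.Periodic u₁ (len N k))
    (hc₂ : Continuous u₂) (hp₂ : Function.Periodic u₂ (len N k)) (j : ℤ) :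
    fourierCoeff (perL2 N k u₂ hc₂ hp₂ : Circ N k → ℂ) j
      = (2 * Real.pi * Complex.I * j / len N k) ^ 2
        * fourierCoeff (perL2 N k u hc hp : Circ N k → ℂ) j := by
  have hc₁ : Continuous u₁ := continuous_iff_continuousAt.2 fun z => (hu.2 z).continuousAt
  rw [fourierCoeff_deriv hc₁ hp₁ hc₂ hp₂ hu.2, fourierCoeff_deriv hc hp hc₁ hp₁ hu.1]
  ring

theorem periodic_of_hasDerivAt {u u₁ : ℝ → ℂ} {T : ℝ} (hd : ∀ z, HasDerivAt u (u₁ z) z)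
    (hp : Function.Periodic u T) : Function.Periodic u₁ T := fun z => by
  have h := (hd (z + T)).comp_add_const z T
  rw [funext hp] at h
  exact h.unique (hd z)

/-- Mean zero is exactly what makes the primitive periodic. The free constant of integration is used
to prescribe the mean of the primitive, so that the construction can be iterated. -/
theorem exists_primitive {h : ℝ → ℂ} (hc : Continuous h) (hp : Function.Periodic h (len N k))
    (h0 : fourierCoeff (perL2 N k h hc hp : Circ N k → ℂ) 0 = 0) (c : ℂ) :
    ∃ (U : ℝ → ℂ) (hU : Continuous U) (hpU : Function.Periodic U (len N k)),
      (∀ z, HasDerivAt U (h z) z) ∧ fourierCoeff (perL2 N k U hU hpU : Circ N k → ℂ) 0 = c := by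
  have hT := (len_pos N k).out
  set P : ℝ → ℂ := fun x => ∫ t in (0 : ℝ)..x, h t with hP
  have hPd : ∀ z, HasDerivAt P (h z) z := fun z => (hc.integral_hasStrictDerivAt 0 z).hasDerivAt
  have hPc : Continuous P := continuous_iff_continuousAt.2 fun z => (hPd z).continuousAt
  have hPp : Function.Periodic P (len N k) := fun z => by
    rw [fourierCoeff_perL2_zero hc hp z, smul_eq_zero] at h0
    have h1 : P (z + len N k) - P z = ∫ t in z..z + len N k, h t :=
      intervalIntegral.integral_interval_sub_left (hc.intervalIntegrable _ _)
        (hc.intervalIntegrable _ _)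
    rw [h0.resolve_left (one_div_pos.2 hT).ne'] at h1
    exact sub_eq_zero.1 h1
  set m := fourierCoeff (perL2 N k P hPc hPp : Circ N k → ℂ) 0 with hm
  have hQp : Function.Periodic (fun z => P z - (m - c)) (len N k) :=
    fun z => congrArg (· - (m - c)) (hPp z)
  have hQc : Continuous fun z => P z - (m - c) := hPc.sub continuous_const
  refine ⟨fun z => P z - (m - c), hQc, hQp, fun z => (hPd z).sub_const _, ?_⟩
  rw [fourierCoeff_perL2_zero hQc hQp 0, intervalIntegral.integral_sub
    (hPc.intervalIntegrable _ _) (continuous_const.intervalIntegrable _ _), smul_sub,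
    ← fourierCoeff_perL2_zero hPc hPp 0, ← hm, intervalIntegral.integral_const, smul_smul]
  have : 1 / len N k * (0 + len N k - 0) = 1 := by field_simp; ring
  rw [this, one_smul]
  ring

/-- A function in `H²` whose second derivative is continuous is twice differentiable. -/
theorem exists_isC2_of_deriv2 (f : Hper N k 2) {h : ℝ → ℂ} (hc : Continuous h)
    (hp : Function.Periodic h (len N k)) (hf : deriv2 N k f = perL2 N k h hc hp) :
    ∃ (U U₁ : ℝ → ℂ) (hU : Continuous U) (hpU : Function.Periodic U (len N k)),
      IsC2 U U₁ h ∧ (f : L2 N k) = perL2 N k U hU hpU := by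
  have h0 : fourierCoeff (perL2 N k h hc hp : Circ N k → ℂ) 0 = 0 := by
    rw [← hf, fourierCoeff_deriv2]
    simp
  -- The first primitive is given mean `0` so that it can be integrated again; the second is given
  -- the mean of `f`, the only coefficient that the second derivative does not determine.
  obtain ⟨U₁, hc₁, hp₁, hd₁, h1⟩ := exists_primitive hc hp h0 0
  obtain ⟨U, hU, hpU, hd, h2⟩ := exists_primitive hc₁ hp₁ h1
    (fourierCoeff ((f : L2 N k) : Circ N k → ℂ) 0)
  refine ⟨U, U₁, hU, hpU, ⟨hd, hd₁⟩, ext_fourierCoeff fun j => ?_⟩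
  by_cases hj : j = 0
  · rw [hj, h2]
  · have e := fourierCoeff_isC2 ⟨hd, hd₁⟩ hU hpU hp₁ hc hp j
    rw [← hf, fourierCoeff_deriv2] at e
    refine mul_left_cancel₀ (pow_ne_zero 2 ?_) e
    have hT' : (len N k : ℂ) ≠ 0 := Complex.ofReal_ne_zero.2 (len_pos N k).out.ne'
    have hn' : (j : ℂ) ≠ 0 := Int.cast_ne_zero.2 hj
    have hpi : (Real.pi : ℂ) ≠ 0 := Complex.ofReal_ne_zero.2 Real.pi_ne_zero
    have hI := Complex.I_ne_zero
    exact div_ne_zero (mul_ne_zero (mul_ne_zero (mul_ne_zero two_ne_zero hpi) hI) hn') hT'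

/-- Functions in `H²` are continuous. -/
theorem exists_eq_perL2 (f : Hper N k 2) :
    ∃ (u : ℝ → ℂ) (hc : Continuous u) (hp : Function.Periodic u (len N k)),
      (f : L2 N k) = perL2 N k u hc hp := by
  have hf : Summable (sobolevTerm N k 2 f) := f.2
  have hs : Summable fun j : ℤ => ‖fourierCoeff ((f : L2 N k) : Circ N k → ℂ) j‖ := by
    have hj : Summable fun j : ℤ => 1 / (1 + (j : ℝ) ^ 2) := by
      refine Summable.of_norm_bounded_eventually
        (g := fun j : ℤ => 1 / (j : ℝ) ^ 2)
        (Real.summable_one_div_int_pow.2 one_lt_two) ?_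
      filter_upwards [Set.Finite.compl_mem_cofinite (Set.finite_singleton (0 : ℤ))] with j hj
      have : (0 : ℝ) < (j : ℝ) ^ 2 := by
        have : (j : ℝ) ≠ 0 := Int.cast_ne_zero.2 hj
        positivity
      rw [Real.norm_of_nonneg (by positivity)]
      gcongr
      linarith
    refine Summable.of_nonneg_of_le (fun j => norm_nonneg _) (fun j => ?_) (hf.add hj)
    set a := ‖fourierCoeff ((f : L2 N k) : Circ N k → ℂ) j‖ with ha
    have ha0 : 0 ≤ a := norm_nonneg _
    have hle : a ^ 2 * (1 + (j : ℝ) ^ 2) ≤ sobolevTerm N k 2 f j := by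
      unfold sobolevTerm
      rw [← ha]
      gcongr
      simp only [Finset.sum_range_succ, Finset.sum_range_zero]
      rw [show 2 * 1 = 2 from rfl, sq_abs]
      have : 0 ≤ |(j : ℝ)| ^ (2 * 2) := by positivity
      simp only [mul_zero, pow_zero, zero_add]
      linarith
    have hq : (0 : ℝ) < 1 + (j : ℝ) ^ 2 := by positivity
    -- Absolute summability by an AM-GM bound: with `q = 1 + j²`, expanding `(aq - 1/2)²/q ≥ 0`
    -- gives `a ≤ a² q + 1/(4q)`, and both terms on the right are summable.
    have h1 : a ≤ a ^ 2 * (1 + (j : ℝ) ^ 2) + 1 / (1 + (j : ℝ) ^ 2) := by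
      have h2 : 0 ≤ (a * (1 + (j : ℝ) ^ 2) - 1 / 2) ^ 2 / (1 + (j : ℝ) ^ 2) := by positivity
      have h3 : (a * (1 + (j : ℝ) ^ 2) - 1 / 2) ^ 2 / (1 + (j : ℝ) ^ 2)
        = a ^ 2 * (1 + (j : ℝ) ^ 2) + (1 / 4) * (1 / (1 + (j : ℝ) ^ 2)) - a := by
        field_simp
        ring
      have h4 : 0 < 1 / (1 + (j : ℝ) ^ 2) := by positivity
      linarith
    linarith
  have hs' : Summable fun j : ℤ => fourierCoeff ((f : L2 N k) : Circ N k → ℂ) j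
      • (fourier j : C(Circ N k, ℂ)) := by
    refine Summable.of_norm ?_
    simpa [norm_smul, fourier_norm] using hs
  have h1 := hs'.hasSum.mapL (ContinuousMap.toLp (E := ℂ) 2 (haarAddCircle (T := len N k)) ℂ)
  have h2 := hasSum_fourier_series_L2 (f : L2 N k)
  -- The Fourier series converges uniformly to a continuous function and in `L²` to `f`; the limits
  -- agree in `L²`.
  have h3 := h1.unique (by simpa only [map_smul] using h2)
  rw [toLp_eq_perL2] at h3
  exact ⟨_, _, _, h3.symm⟩

end Periodic

/-! ### Periodic solutions of `u'' = q u` -/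

/-- The Wronskian is constant because the equation has no first-order term. -/
theorem wronskian_eq {q u u₁ v v₁ : ℝ → ℂ} (hu : IsC2 u u₁ fun z => q z * u z)
    (hv : IsC2 v v₁ fun z => q z * v z) (x y : ℝ) :
    u x * v₁ x - u₁ x * v x = u y * v₁ y - u₁ y * v y := by
  have hd : ∀ z, HasDerivAt (fun z => u z * v₁ z - u₁ z * v z) 0 z := fun z => by
    refine (((hu.1 z).mul (hv.2 z)).sub ((hu.2 z).mul (hv.1 z))).congr_deriv ?_
    ring
  exact is_const_of_deriv_eq_zero (fun z => (hd z).differentiableAt) (fun z => (hd z).deriv) x y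

/-- If `p` is a periodic solution of `u'' = q u` and a second solution `w` satisfies
`w (z + T) = w z + J p z` with `J ≠ 0`, then every periodic solution is a multiple of `p`. -/
theorem exists_eq_const_mul {q p p₁ w w₁ u u₁ : ℝ → ℂ} {T : ℝ} {J : ℂ}
    (hp : IsC2 p p₁ fun z => q z * p z) (hw : IsC2 w w₁ fun z => q z * w z)
    (hu : IsC2 u u₁ fun z => q z * u z)
    (hwT : ∀ z, w (z + T) = w z + J * p z) (huT : Function.Periodic u T) (hJ : J ≠ 0)
    (hW : p 0 * w₁ 0 - p₁ 0 * w 0 ≠ 0) : ∃ c : ℂ, ∀ z, u z = c * p z := by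
  have hu₁T := periodic_of_hasDerivAt hu.1 huT
  have hw₁T : w₁ (0 + T) = w₁ 0 + J * p₁ 0 := by
    have h := (hw.1 (0 + T)).comp_add_const 0 T
    rw [funext hwT] at h
    exact h.unique ((hw.1 0).add ((hp.1 0).const_mul J))
  have h1 := wronskian_eq hu hw (0 + T) 0
  rw [hwT, huT, hu₁T, hw₁T] at h1
  -- Shifting by `T` changes `W(u, w)` by `J W(u, p)`, while Wronskians are constant; hence `W(u, p)
  -- = 0`.
  have h2 : u 0 * p₁ 0 - u₁ 0 * p 0 = 0 := by
    refine (mul_eq_zero.1 (?_ : J * _ = 0)).resolve_left hJ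
    linear_combination h1
  -- The constant is `W(u, w) / W(p, w)`, read off from `u W(p, w) = p W(u, w) - w W(u, p)`.
  refine ⟨(u 0 * w₁ 0 - u₁ 0 * w 0) / (p 0 * w₁ 0 - p₁ 0 * w 0), fun z => ?_⟩
  have e1 := wronskian_eq hu hp z 0
  have e2 := wronskian_eq hu hw z 0
  have e3 := wronskian_eq hp hw z 0
  rw [h2] at e1
  rw [div_mul_eq_mul_div, eq_div_iff hW, ← e3, ← e2]
  linear_combination -w z * e1

theorem IsC2.ofReal {u u₁ u₂ : ℝ → ℝ} (h : IsC2 u u₁ u₂) :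
    IsC2 (fun z => (u z : ℂ)) (fun z => (u₁ z : ℂ)) fun z => (u₂ z : ℂ) :=
  ⟨fun z => (h.1 z).ofReal_comp, fun z => (h.2 z).ofReal_comp⟩

/-- Since `(z dn)'' = z dn'' + 2 dn'`, adding `E z dn` cancels the source term `-2E dn'` of `φ`. -/
theorem isC2_minus_second (k : Modulus) :
    IsC2 (fun z => phi k z + ellE k * (z * dn k z))
      (fun z => phiDeriv k z + ellE k * (dn k z + z * dnDeriv k z))
      fun z => (2 - (k : ℝ) ^ 2 - 2 * dn k z ^ 2) * (phi k z + ellE k * (z * dn k z)) := by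
  have h := isC2_phi k
  have h' := isC2_dn k
  constructor
  · intro z
    refine ((h.1 z).add (((hasDerivAt_id z).mul (h'.1 z)).const_mul (ellE k))).congr_deriv ?_
    simp
  · intro z
    refine ((h.2 z).add (((h'.1 z).add ((hasDerivAt_id z).mul (h'.2 z))).const_mul
      (ellE k))).congr_deriv ?_
    simp only [id]
    ring

/-- `z dn' + dn` is the derivative of `λ dn(λz)` at `λ = 1`, the scaling direction of the nonlinear
equation. It leaves the source `2(2-k²) dn`, which the multiple of `ϕ`, with source `-plusConst ·
dn`, cancels. -/
theorem isC2_plus_second (k : Modulus) :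
    IsC2 (fun z => plusConst k * (z * dnDeriv k z + dn k z) + 2 * (2 - (k : ℝ) ^ 2) * varphi k z)
      (fun z => plusConst k * (2 * dnDeriv k z
        + z * ((2 - (k : ℝ) ^ 2) * dn k z - 2 * dn k z ^ 3))
        + 2 * (2 - (k : ℝ) ^ 2) * varphiDeriv k z)
      fun z => (2 - (k : ℝ) ^ 2 - 6 * dn k z ^ 2) *
        (plusConst k * (z * dnDeriv k z + dn k z) + 2 * (2 - (k : ℝ) ^ 2) * varphi k z) := by
  have h := isC2_varphi k
  have h' := isC2_dn k
  have h'' := isC2_dnDeriv k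
  constructor
  · intro z
    refine (((((hasDerivAt_id z).mul (h''.1 z)).add (h'.1 z)).const_mul _).add
      ((h.1 z).const_mul _)).congr_deriv ?_
    simp only [id]
    ring
  · intro z
    refine (((((h'.2 z).const_mul 2).add ((hasDerivAt_id z).mul (h''.2 z))).const_mul _).add
      ((h.2 z).const_mul _)).congr_deriv ?_
    simp only [id]
    ring

/-! ### The operators on smooth functions -/

section Operators

variable {N : ℕ+} {k : Modulus}

/-- The potential `2 - k² - a dn²`, with real values. -/
noncomputable def potential (k : Modulus) (a : ℝ) (z : ℝ) : ℝ := 2 - (k : ℝ) ^ 2 - a * dn k z ^ 2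

theorem continuous_potential (k : Modulus) (a : ℝ) : Continuous (potential k a) := by
  have := continuous_dn k
  unfold potential
  fun_prop

theorem potential_periodic (N : ℕ+) (k : Modulus) (a : ℝ) :
    Function.Periodic (potential k a) (len N k) := fun z => by
  simp only [potential, periodic_len N k (dn_periodic k) z]

theorem schrodingerOp_apply (a : ℝ) (f : Hper N k 2) :
    schrodingerOp N k a f
      = -deriv2 N k f + mulOp N k (potential k a) (continuous_potential k a) f := by
  have h : (fun z => -a * dn k z ^ 2 - (k : ℝ) ^ 2 + 2) = potential k a := by
    funext z
    unfold potential
    ring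
  unfold schrodingerOp
  simp only [h]
  rfl

theorem perL2_mem_Hper {u u₁ u₂ : ℝ → ℂ} (hu : IsC2 u u₁ u₂) (hc : Continuous u)
    (hp : Function.Periodic u (len N k)) (hc₂ : Continuous u₂) :
    perL2 N k u hc hp ∈ Hper N k 2 := by
  have hp₁ := periodic_of_hasDerivAt hu.1 hp
  exact mem_Hper_two (fourierCoeff_isC2 hu hc hp hp₁ hc₂ (periodic_of_hasDerivAt hu.2 hp₁))

/-- The operator on a periodic solution of `u'' = q u - g`. -/
theorem schrodingerOp_perL2 {a : ℝ} {u u₁ u₂ g : ℝ → ℂ} (hu : IsC2 u u₁ u₂) (hc : Continuous u)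
    (hp : Function.Periodic u (len N k)) (hc₂ : Continuous u₂) (hgc : Continuous g)
    (hgp : Function.Periodic g (len N k)) (h : ∀ z, u₂ z = potential k a z * u z - g z)
    (hm : perL2 N k u hc hp ∈ Hper N k 2) :
    schrodingerOp N k a ⟨perL2 N k u hc hp, hm⟩ = perL2 N k g hgc hgp := by
  have hp₁ := periodic_of_hasDerivAt hu.1 hp
  have hp₂ := periodic_of_hasDerivAt hu.2 hp₁
  have h2 : deriv2 N k ⟨perL2 N k u hc hp, hm⟩ = perL2 N k u₂ hc₂ hp₂ :=
    ext_fourierCoeff fun j => by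
      rw [fourierCoeff_deriv2, fourierCoeff_isC2 hu hc hp hp₁ hc₂ hp₂]
  rw [schrodingerOp_apply, h2, mulOp_perL2 _ (potential_periodic N k a), neg_add_eq_sub,
    perL2_sub]
  exact perL2_congr (funext fun z => by rw [h]; ring) _ _

/-- Elements of the kernel are classical solutions. -/
theorem exists_isC2_of_schrodingerOp_eq_zero {a : ℝ} (f : Hper N k 2)
    (hf : schrodingerOp N k a f = 0) :
    ∃ (u u₁ : ℝ → ℂ) (hc : Continuous u) (hp : Function.Periodic u (len N k)),
      IsC2 u u₁ (fun z => potential k a z * u z) ∧ (f : L2 N k) = perL2 N k u hc hp := by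
  obtain ⟨u, hc, hp, hu⟩ := exists_eq_perL2 f
  rw [schrodingerOp_apply, hu, mulOp_perL2 _ (potential_periodic N k a), neg_add_eq_zero] at hf
  -- The kernel equation now says that the second derivative of `f` is the continuous function
  -- `potential · u`, so `f` has a twice differentiable representative; it equals `u` since
  -- continuous representatives are unique.
  obtain ⟨U, U₁, hU, hpU, h2, h3⟩ := exists_isC2_of_deriv2 f _ _ hf
  have h4 : u = U := perL2_injective (hu.symm.trans h3)
  subst h4
  exact ⟨u, U₁, hc, hp, h2, hu⟩

/-- One-dimensional kernels: a periodic real solution together with a second solution that is not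
periodic. -/
theorem exists_smul_of_schrodingerOp_eq_zero {a : ℝ} {p p₁ w w₁ : ℝ → ℝ} {J : ℝ}
    (hpc : Continuous p) (hpp : Function.Periodic p (len N k))
    (hp : IsC2 p p₁ fun z => potential k a z * p z)
    (hw : IsC2 w w₁ fun z => potential k a z * w z) (hJ : J ≠ 0)
    (hwT : ∀ z, w (z + len N k) = w z + J * p z)
    (hW : p 0 * w₁ 0 - p₁ 0 * w 0 ≠ 0) (f : Hper N k 2) (hf : schrodingerOp N k a f = 0) :
    ∃ c : ℂ, (f : L2 N k) = c • toL2 N k p hpc := by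
  obtain ⟨u, u₁, hc, hpu, hu, hfu⟩ := exists_isC2_of_schrodingerOp_eq_zero f hf
  have hp' := hp.ofReal
  have hw' := hw.ofReal
  simp only [Complex.ofReal_mul] at hp' hw'
  obtain ⟨c, hcz⟩ := exists_eq_const_mul (J := (J : ℂ)) hp' hw' hu
    (fun z => by rw [hwT z]; push_cast; rfl) hpu
    (Complex.ofReal_ne_zero.2 hJ) (by exact_mod_cast hW)
  refine ⟨c, ?_⟩
  rw [toL2_eq_perL2 hpc hpp, hfu, perL2_smul]
  exact perL2_congr (funext hcz) _ _

/-! ### Symmetry -/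

theorem inner_eq_tsum_fourierCoeff (f g : L2 N k) :
    inner ℂ f g = ∑' j : ℤ, inner ℂ (fourierCoeff (f : Circ N k → ℂ) j)
      (fourierCoeff (g : Circ N k → ℂ) j) := by
  rw [← fourierBasis.repr.inner_map_map, lp.inner_eq_tsum]
  simp only [fourierBasis_repr]

/-- The symbol is real, being the square of an imaginary number; this is the symmetry of the second
derivative. -/
theorem conj_symbol (T : ℝ) (j : ℤ) :
    conj ((2 * Real.pi * Complex.I * j / T : ℂ) ^ 2) = (2 * Real.pi * Complex.I * j / T) ^ 2 := by
  simp only [map_pow, map_div₀, map_mul, Complex.conj_ofReal, Complex.conj_I, map_ofNat,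
    map_intCast]
  ring

theorem inner_deriv2_left (f g : Hper N k 2) :
    inner ℂ (deriv2 N k f) (g : L2 N k) = inner ℂ (f : L2 N k) (deriv2 N k g) := by
  rw [inner_eq_tsum_fourierCoeff, inner_eq_tsum_fourierCoeff]
  refine tsum_congr fun j => ?_
  rw [fourierCoeff_deriv2, fourierCoeff_deriv2, RCLike.inner_apply, RCLike.inner_apply, map_mul,
    conj_symbol]
  ring

theorem inner_mulOp_left {h : ℝ → ℝ} (hc : Continuous h) (f g : L2 N k) :
    inner ℂ (mulOp N k h hc f) g = inner ℂ f (mulOp N k h hc g) := by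
  rw [L2.inner_def, L2.inner_def]
  refine integral_congr_ae ?_
  filter_upwards [MemLp.coeFn_toLp (memLp_onCirc_mul N k hc f),
    MemLp.coeFn_toLp (memLp_onCirc_mul N k hc g)] with x hx hx'
  have e1 : (mulOp N k h hc f : Circ N k → ℂ) x = onCirc N k h x * f x := hx
  have e2 : (mulOp N k h hc g : Circ N k → ℂ) x = onCirc N k h x * g x := hx'
  rw [e1, e2, RCLike.inner_apply, RCLike.inner_apply, map_mul]
  have e3 : conj (onCirc N k h x) = onCirc N k h x := Complex.conj_ofReal _
  rw [e3]
  ring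

theorem inner_schrodingerOp_left (a : ℝ) (f g : Hper N k 2) :
    inner ℂ (schrodingerOp N k a f) (g : L2 N k)
      = inner ℂ (f : L2 N k) (schrodingerOp N k a g) := by
  rw [schrodingerOp_apply, schrodingerOp_apply, inner_add_left, inner_add_right, inner_neg_left,
    inner_neg_right, inner_deriv2_left, inner_mulOp_left]

/-- The inner product of two real periodic functions whose product has an antiderivative. -/
theorem inner_toL2 {u v G : ℝ → ℝ} {c : ℝ} (hu : Continuous u)
    (hup : Function.Periodic u (len N k)) (hv : Continuous v)
    (hvp : Function.Periodic v (len N k)) (hG : ∀ z, HasDerivAt G (u z * v z) z)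
    (hGT : G (len N k) = G 0 + c * len N k) :
    inner ℂ (toL2 N k u hu) (toL2 N k v hv) = (c : ℂ) := by
  have hT := (len_pos N k).out
  -- For real functions the normalised inner product is the mean of the product, that is, its zeroth
  -- Fourier coefficient.
  have h1 : inner ℂ (toL2 N k u hu) (toL2 N k v hv) = fourierCoeff (perL2 N k
      (fun z => ((u z * v z : ℝ) : ℂ)) (Complex.continuous_ofReal.comp (hu.mul hv))
      (periodic_ofReal (hup.mul hvp)) : Circ N k → ℂ) 0 := by
    rw [toL2_eq_perL2 hu hup, toL2_eq_perL2 hv hvp, perL2, perL2, perL2, fourierCoeff_toLp,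
      ContinuousMap.inner_toLp]
    refine integral_congr_ae (Filter.Eventually.of_forall fun x => ?_)
    induction x using QuotientAddGroup.induction_on with
    | H x =>
      have e := fun (w : ℝ → ℂ) hc hp => circMap_coe (N := N) (k := k) (u := w) hc hp x
      simp [e, mul_comm]
  rw [h1, fourierCoeff_perL2_zero _ _ 0, intervalIntegral.integral_ofReal,
    intervalIntegral.integral_eq_sub_of_hasDerivAt (fun x _ => hG x)
      ((hu.mul hv).intervalIntegrable _ _), zero_add, hGT]
  rw [Complex.real_smul, ← Complex.ofReal_mul]
  congr 1
  field_simp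
  ring

end Operators

section Kernels

variable {N : ℕ+} {k : Modulus}

/-! ### The kernels of `L₋` and `L₊` -/

theorem toL2_mem_Hper {u u₁ u₂ : ℝ → ℝ} (hu : IsC2 u u₁ u₂) (hc : Continuous u)
    (hp : Function.Periodic u (len N k)) (hc₂ : Continuous u₂) :
    toL2 N k u hc ∈ Hper N k 2 := by
  rw [toL2_eq_perL2 hc hp]
  exact perL2_mem_Hper hu.ofReal _ _ (Complex.continuous_ofReal.comp hc₂)

theorem toL2_const_mul (c : ℝ) {u : ℝ → ℝ} (hc : Continuous u)
    (hp : Function.Periodic u (len N k)) :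
    toL2 N k (fun z => c * u z) (continuous_const.mul hc) = (c : ℂ) • toL2 N k u hc := by
  rw [toL2_eq_perL2 hc hp, perL2_smul,
    toL2_eq_perL2 (h := fun z => c * u z) (continuous_const.mul hc) (fun z => congrArg (c * ·) (hp z))]
  exact perL2_congr (funext fun z => Complex.ofReal_mul _ _) _ _

theorem schrodingerOp_toL2 {a c : ℝ} {u u₁ u₂ g : ℝ → ℝ} (hu : IsC2 u u₁ u₂) (hc : Continuous u)
    (hp : Function.Periodic u (len N k)) (hg : Continuous g)
    (hgp : Function.Periodic g (len N k)) (h : ∀ z, u₂ z = potential k a z * u z - c * g z)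
    (hm : toL2 N k u hc ∈ Hper N k 2) :
    schrodingerOp N k a ⟨toL2 N k u hc, hm⟩ = (c : ℂ) • toL2 N k g hg := by
  have hc₂ : Continuous u₂ := by
    rw [funext h]
    exact ((continuous_potential k a).mul hc).sub (continuous_const.mul hg)
  have hcgp : Function.Periodic (fun z => c * g z) (len N k) := fun z => congrArg (c * ·) (hgp z)
  rw [← toL2_const_mul c hg hgp, toL2_eq_perL2 _ hcgp]
  exact schrodingerOp_perL2 hu.ofReal (Complex.continuous_ofReal.comp hc) (periodic_ofReal hp)
    (Complex.continuous_ofReal.comp hc₂)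
    (Complex.continuous_ofReal.comp (continuous_const.mul hg)) (periodic_ofReal hcgp)
    (fun z => by
      rw [h]
      exact (Complex.ofReal_sub _ _).trans (congrArg (· - _) (Complex.ofReal_mul _ _))) hm

theorem dn_periodic_len (N : ℕ+) (k : Modulus) : Function.Periodic (dn k) (len N k) :=
  periodic_len N k (dn_periodic k)

theorem dnDeriv_periodic_len (N : ℕ+) (k : Modulus) : Function.Periodic (dnDeriv k) (len N k) :=
  periodic_len N k (dnDeriv_periodic k)

theorem phi_periodic_len (N : ℕ+) (k : Modulus) : Function.Periodic (phi k) (len N k) :=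
  periodic_len N k (phi_periodic k)

theorem varphi_periodic_len (N : ℕ+) (k : Modulus) : Function.Periodic (varphi k) (len N k) :=
  periodic_len N k (varphi_periodic k)

theorem snCn_periodic_len (N : ℕ+) (k : Modulus) :
    Function.Periodic (fun z => sn k z * cn k z) (len N k) :=
  periodic_len N k fun z => by simp [sn, cn, am_add]

theorem toL2_dnDeriv (N : ℕ+) (k : Modulus) :
    toL2 N k (dnDeriv k) (continuous_dnDeriv k) = ((-(k : ℝ) ^ 2 : ℝ) : ℂ) • snCnL2 N k :=
  toL2_const_mul _ (continuous_sn_mul_cn k) (snCn_periodic_len N k)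

theorem neg_sq_ne_zero (k : Modulus) : ((-(k : ℝ) ^ 2 : ℝ) : ℂ) ≠ 0 :=
  Complex.ofReal_ne_zero.2 (neg_ne_zero.2 (pow_ne_zero 2 k.2.1.ne'))

theorem snCnL2_eq (N : ℕ+) (k : Modulus) : snCnL2 N k
    = ((-(k : ℝ) ^ 2 : ℝ) : ℂ)⁻¹ • toL2 N k (dnDeriv k) (continuous_dnDeriv k) := by
  rw [toL2_dnDeriv, smul_smul, inv_mul_cancel₀ (neg_sq_ne_zero k), one_smul]

theorem dnL2_mem (N : ℕ+) (k : Modulus) : dnL2 N k ∈ Hper N k 2 :=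
  toL2_mem_Hper (isC2_dn k) _ (dn_periodic_len N k) (by have := continuous_dn k; fun_prop)

theorem dnDerivL2_mem (N : ℕ+) (k : Modulus) :
    toL2 N k (dnDeriv k) (continuous_dnDeriv k) ∈ Hper N k 2 :=
  toL2_mem_Hper (isC2_dnDeriv k) _ (dnDeriv_periodic_len N k)
    (by have := continuous_dn k; have := continuous_dnDeriv k; fun_prop)

theorem snCnL2_mem (N : ℕ+) (k : Modulus) : snCnL2 N k ∈ Hper N k 2 := by
  rw [snCnL2_eq]
  exact Submodule.smul_mem _ _ (dnDerivL2_mem N k)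

theorem phiL2_mem (N : ℕ+) (k : Modulus) : phiL2 N k ∈ Hper N k 2 :=
  toL2_mem_Hper (isC2_phi k) _ (phi_periodic_len N k)
    (by
      have := continuous_dn k
      have := continuous_dnDeriv k
      have := continuous_phi k
      fun_prop)

theorem varphiL2_mem (N : ℕ+) (k : Modulus) : varphiL2 N k ∈ Hper N k 2 :=
  toL2_mem_Hper (isC2_varphi k) _ (varphi_periodic_len N k)
    (by
      have := continuous_dn k
      have := continuous_varphi k
      fun_prop)

theorem Lminus_dnL2 (h : dnL2 N k ∈ Hper N k 2) : Lminus N k ⟨dnL2 N k, h⟩ = 0 := by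
  have := schrodingerOp_toL2 (a := 2) (c := 0) (isC2_dn k) (continuous_dn k) (dn_periodic_len N k)
    (continuous_dn k) (dn_periodic_len N k) (fun z => by unfold potential; ring) h
  rwa [Complex.ofReal_zero, zero_smul] at this

theorem Lplus_dnDeriv (h : toL2 N k (dnDeriv k) (continuous_dnDeriv k) ∈ Hper N k 2) :
    Lplus N k ⟨toL2 N k (dnDeriv k) (continuous_dnDeriv k), h⟩ = 0 := by
  have := schrodingerOp_toL2 (a := 6) (c := 0) (isC2_dnDeriv k) (continuous_dnDeriv k)
    (dnDeriv_periodic_len N k) (continuous_dn k) (dn_periodic_len N k)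
    (fun z => by unfold potential; ring) h
  rwa [Complex.ofReal_zero, zero_smul] at this

theorem Lplus_snCnL2 (h : snCnL2 N k ∈ Hper N k 2) : Lplus N k ⟨snCnL2 N k, h⟩ = 0 := by
  have e : (⟨snCnL2 N k, h⟩ : Hper N k 2) = ((-(k : ℝ) ^ 2 : ℝ) : ℂ)⁻¹ •
      ⟨toL2 N k (dnDeriv k) (continuous_dnDeriv k), dnDerivL2_mem N k⟩ :=
    Subtype.ext (snCnL2_eq N k)
  rw [e, map_smul, Lplus_dnDeriv, smul_zero]

theorem Lminus_phiL2 (h : phiL2 N k ∈ Hper N k 2) : Lminus N k ⟨phiL2 N k, h⟩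
    = ((2 * ellE k * -(k : ℝ) ^ 2 : ℝ) : ℂ) • snCnL2 N k := by
  rw [Complex.ofReal_mul, mul_smul, ← toL2_dnDeriv]
  exact schrodingerOp_toL2 (isC2_phi k) _ (phi_periodic_len N k) (continuous_dnDeriv k)
    (dnDeriv_periodic_len N k) (fun z => by unfold potential; ring) h

theorem Lplus_varphiL2 (h : varphiL2 N k ∈ Hper N k 2) :
    Lplus N k ⟨varphiL2 N k, h⟩ = (plusConst k : ℂ) • dnL2 N k :=
  schrodingerOp_toL2 (isC2_varphi k) _ (varphi_periodic_len N k) (continuous_dn k)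
    (dn_periodic_len N k) (fun z => by unfold potential; ring) h

theorem exists_smul_of_Lminus_eq_zero (f : Hper N k 2) (hf : Lminus N k f = 0) :
    ∃ c : ℂ, (f : L2 N k) = c • dnL2 N k := by
  have hT := (len_pos N k).out
  have hk : (k : ℝ) ^ 2 < 1 := by nlinarith [k.2.1, k.2.2]
  refine exists_smul_of_schrodingerOp_eq_zero (a := 2) (J := ellE k * len N k) (continuous_dn k)
    (dn_periodic_len N k) (p₁ := dnDeriv k) ?_ (isC2_minus_second k)
    (mul_pos (ellE_pos k) hT).ne' (fun z => ?_) ?_ f hf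
  · convert! isC2_dn k using 2 with z
    unfold potential
    ring
  · rw [phi_periodic_len N k z, dn_periodic_len N k z]
    ring
  -- The Wronskian at `0` is `(1 - k²) K`.
  · simp only [phiDeriv, zetaFun_zero, dn_zero, dnDeriv_zero]
    have := mul_pos (ellK_pos k) (sub_pos.2 hk)
    apply ne_of_gt
    linarith

theorem exists_smul_of_Lplus_eq_zero (f : Hper N k 2) (hf : Lplus N k f = 0) :
    ∃ c : ℂ, (f : L2 N k) = c • snCnL2 N k := by
  have hT := (len_pos N k).out
  have hk : (k : ℝ) ^ 2 < 1 := by nlinarith [k.2.1, k.2.2]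
  have hk0 : 0 < (k : ℝ) ^ 2 := pow_pos k.2.1 2
  obtain ⟨c, hc⟩ := exists_smul_of_schrodingerOp_eq_zero (a := 6) (J := plusConst k * len N k)
    (continuous_dnDeriv k) (dnDeriv_periodic_len N k) (isC2_dnDeriv k) (isC2_plus_second k)
    (mul_ne_zero (plusConst_ne_zero k) hT.ne') (fun z => by
      rw [varphi_periodic_len N k z, dn_periodic_len N k z, dnDeriv_periodic_len N k z]
      ring) (by
      -- Here `dn'(0) = 0` and `dn''(0) = -k²`, and the second solution takes the value `2k²(1-k²)K`
      -- at `0`; the Wronskian is `2k⁴(1-k²)K`.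
      simp only [varphi_eq, zetaFun_zero, dn_zero, dnDeriv_zero, plusConst]
      have := mul_pos (mul_pos (mul_pos hk0 hk0) (ellK_pos k)) (sub_pos.2 hk)
      apply ne_of_gt
      nlinarith) f hf
  exact ⟨c * ((-(k : ℝ) ^ 2 : ℝ) : ℂ), by rw [hc, mul_smul, ← toL2_dnDeriv]⟩

/-! ### Inner products -/

theorem incE_eq (k : Modulus) (z : ℝ) : incE k z = (zetaFun k z + ellE k * z) / ellK k := by
  have := (ellK_pos k).ne'
  unfold zetaFun
  field_simp
  ring

theorem incE_len (N : ℕ+) (k : Modulus) : incE k (len N k) = ellE k * len N k / ellK k := by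
  rw [incE_eq]
  have := periodic_len N k (zetaFun_periodic k) 0
  rw [zero_add, zetaFun_zero] at this
  rw [this, zero_add]

/-- In the antiderivative of `dn ϕ` the periodic terms drop out over a period; only `E · E(z)/2` and
the linear term contribute. -/
theorem inner_dn_varphi (N : ℕ+) (k : Modulus) : inner ℂ (dnL2 N k) (varphiL2 N k)
    = (((ellE k ^ 2 - (1 - (k : ℝ) ^ 2) * ellK k ^ 2) / (2 * ellK k) : ℝ) : ℂ) := by
  refine inner_toL2 _ (dn_periodic_len N k) _ (varphi_periodic_len N k)
    (hasDerivAt_dn_mul_varphi k) ?_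
  have h1 := periodic_len N k (zetaFun_periodic k) 0
  have h2 := dn_periodic_len N k 0
  have h3 := dnDeriv_periodic_len N k 0
  rw [zero_add] at h1 h2 h3
  rw [h1, h2, h3, incE_len, incE_zero]
  have := (ellK_pos k).ne'
  field_simp
  ring

theorem inner_dnDeriv_phi (N : ℕ+) (k : Modulus) :
    inner ℂ (toL2 N k (dnDeriv k) (continuous_dnDeriv k)) (phiL2 N k)
    = (((ellE k ^ 2 - (1 - (k : ℝ) ^ 2) * ellK k ^ 2) / (2 * ellK k) : ℝ) : ℂ) := by
  refine inner_toL2 _ (dnDeriv_periodic_len N k) _ (phi_periodic_len N k)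
    (hasDerivAt_dnDeriv_mul_phi k) ?_
  have h1 := periodic_len N k (zetaFun_periodic k) 0
  have h2 := dn_periodic_len N k 0
  have h3 := dnDeriv_periodic_len N k 0
  rw [zero_add] at h1 h2 h3
  rw [h1, h2, h3, incE_len, incE_zero]
  have := (ellK_pos k).ne'
  field_simp
  ring

theorem inner_const_ne_zero (k : Modulus) :
    (((ellE k ^ 2 - (1 - (k : ℝ) ^ 2) * ellK k ^ 2) / (2 * ellK k) : ℝ) : ℂ) ≠ 0 :=
  Complex.ofReal_ne_zero.2 (div_pos (sub_pos.2 (one_sub_sq_mul_ellK_sq_lt k))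
    (mul_pos two_pos (ellK_pos k))).ne'

theorem inner_dn_varphi_ne_zero (N : ℕ+) (k : Modulus) :
    inner ℂ (dnL2 N k) (varphiL2 N k) ≠ 0 := by
  rw [inner_dn_varphi]
  exact inner_const_ne_zero k

theorem inner_snCn_phi_ne_zero (N : ℕ+) (k : Modulus) :
    inner ℂ (snCnL2 N k) (phiL2 N k) ≠ 0 := fun h => by
  apply inner_const_ne_zero k
  rw [← inner_dnDeriv_phi N k, toL2_dnDeriv, inner_smul_left, h, mul_zero]

/-- The range of a symmetric operator is orthogonal to its kernel. -/
theorem inner_dn_Lminus (f : Hper N k 2) : inner ℂ (dnL2 N k) (Lminus N k f) = 0 := by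
  have h := inner_schrodingerOp_left 2 ⟨dnL2 N k, dnL2_mem N k⟩ f
  have h2 : schrodingerOp N k 2 ⟨dnL2 N k, dnL2_mem N k⟩ = 0 := Lminus_dnL2 _
  rw [h2, inner_zero_left] at h
  exact h.symm

theorem inner_snCn_Lplus (f : Hper N k 2) : inner ℂ (snCnL2 N k) (Lplus N k f) = 0 := by
  have h := inner_schrodingerOp_left 6 ⟨snCnL2 N k, snCnL2_mem N k⟩ f
  have h2 : schrodingerOp N k 6 ⟨snCnL2 N k, snCnL2_mem N k⟩ = 0 := Lplus_snCnL2 _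
  rw [h2, inner_zero_left] at h
  exact h.symm

/-- No integral is needed: `dn` is a multiple of `L₊ ϕ`, and the range of `L₊` is orthogonal to `sn
cn`. -/
theorem inner_snCn_dn (N : ℕ+) (k : Modulus) : inner ℂ (snCnL2 N k) (dnL2 N k) = 0 := by
  have h := inner_snCn_Lplus ⟨varphiL2 N k, varphiL2_mem N k⟩
  rw [Lplus_varphiL2, inner_smul_right] at h
  exact (mul_eq_zero.1 h).resolve_left (Complex.ofReal_ne_zero.2 (plusConst_ne_zero k))

theorem inner_dn_snCn (N : ℕ+) (k : Modulus) : inner ℂ (dnL2 N k) (snCnL2 N k) = 0 :=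
  inner_eq_zero_symm.1 (inner_snCn_dn N k)

end Kernels

section Adjoint

variable {N : ℕ+} {k : Modulus}

/-! ### The adjoint -/

theorem fourierCoeff_fourierLp (n j : ℤ) :
    fourierCoeff ((fourierLp 2 n : L2 N k) : Circ N k → ℂ) j = if j = n then 1 else 0 := by
  rw [fourierCoeff_toLp, fourierCoeff_fourier, Pi.single_apply]

theorem fourierLp_mem (n : ℤ) : (fourierLp 2 n : L2 N k) ∈ Hper N k 2 := by
  refine mem_Hper_two (w := (2 * Real.pi * Complex.I * n / len N k : ℂ) ^ 2 • fourierLp 2 n)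
    fun j => ?_
  rw [fourierCoeff_L2_smul, fourierCoeff_fourierLp]
  split_ifs with h
  · rw [h]
  · simp

theorem deriv2_fourierLp (n : ℤ) (h : (fourierLp 2 n : L2 N k) ∈ Hper N k 2) :
    deriv2 N k ⟨fourierLp 2 n, h⟩
      = (2 * Real.pi * Complex.I * n / len N k : ℂ) ^ 2 • (fourierLp 2 n : L2 N k) := by
  refine ext_fourierCoeff fun j => ?_
  rw [fourierCoeff_deriv2, fourierCoeff_L2_smul, fourierCoeff_fourierLp]
  split_ifs with h
  · rw [h]
  · simp

theorem inner_fourierLp_left (f : L2 N k) (n : ℤ) :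
    inner ℂ (fourierLp 2 n : L2 N k) f = fourierCoeff (f : Circ N k → ℂ) n := by
  rw [← fourierBasis_repr, HilbertBasis.repr_apply_apply, coe_fourierBasis]

theorem dense_Hper_two (N : ℕ+) (k : Modulus) : Dense (Hper N k 2 : Set (L2 N k)) := by
  rw [Submodule.dense_iff_topologicalClosure_eq_top, ← top_le_iff,
    ← span_fourierLp_closure_eq_top (T := len N k) (p := 2) (by simp)]
  refine Submodule.topologicalClosure_mono (Submodule.span_le.2 ?_)
  rintro _ ⟨n, rfl⟩
  exact fourierLp_mem n

/-- `L₋` and `L₊` are self-adjoint: weak solutions are strong solutions. -/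
theorem schrodingerOp_eq_of_inner (a : ℝ) {f w : L2 N k}
    (h : ∀ g : Hper N k 2, inner ℂ w (g : L2 N k) = inner ℂ f (schrodingerOp N k a g)) :
    ∃ hf : f ∈ Hper N k 2, schrodingerOp N k a ⟨f, hf⟩ = w := by
  set q := mulOp N k (potential k a) (continuous_potential k a) f with hq
  -- Testing against the exponentials shows that `q - w` has the Fourier coefficients of the second
  -- derivative of `f`, which puts `f` in `H²`.
  have key : ∀ j : ℤ, fourierCoeff ((q - w : L2 N k) : Circ N k → ℂ) j
      = (2 * Real.pi * Complex.I * j / len N k) ^ 2 * fourierCoeff (f : Circ N k → ℂ) j := by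
    intro j
    have h1 := h ⟨fourierLp 2 j, fourierLp_mem j⟩
    rw [schrodingerOp_apply, deriv2_fourierLp, inner_add_right, inner_neg_right,
      ← inner_mulOp_left, ← hq, inner_smul_right] at h1
    have h2 := congrArg conj h1
    simp only [map_add, map_neg, map_mul, inner_conj_symm, conj_symbol] at h2
    rw [← inner_fourierLp_left, ← inner_fourierLp_left, inner_sub_right]
    rw [h2]
    ring
  have hf := mem_Hper_two key
  refine ⟨hf, ?_⟩
  have hd : deriv2 N k ⟨f, hf⟩ = q - w := ext_fourierCoeff fun j => by
    rw [fourierCoeff_deriv2, key]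
  rw [schrodingerOp_apply, hd]
  simp only [← hq]
  abel

/-- The constant `-(β/2) B²`. -/
noncomputable def scale (β : ℝ) (N : ℕ+) (k : Modulus) : ℝ :=
  -(β / 2) * (ellK k * N / Real.pi) ^ 2

theorem scale_pos {β : ℝ} (hβ : β < 0) (N : ℕ+) (k : Modulus) : 0 < scale β N k := by
  have h1 := ellK_pos k
  have h2 : (0 : ℝ) < N := Nat.cast_pos.2 N.pos
  have h3 := Real.pi_pos
  unfold scale
  have : 0 < -(β / 2) := by linarith
  positivity

theorem pair_mem_HperPairs {m : ℕ} {f g : L2 N k} (hf : f ∈ Hper N k m) (hg : g ∈ Hper N k m) :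
    pair f g ∈ HperPairs N k m := ⟨hf, hg⟩

theorem linOp_apply (β : ℝ) {f g : L2 N k} (hf : f ∈ Hper N k 2) (hg : g ∈ Hper N k 2) :
    linOp β N k ⟨pair f g, pair_mem_HperPairs hf hg⟩
      = (scale β N k : ℂ) • pair (Lminus N k ⟨g, hg⟩) (-Lplus N k ⟨f, hf⟩) := rfl

theorem inner_pair (a b c d : L2 N k) :
    inner ℂ (pair a b) (pair c d) = inner ℂ a c + inner ℂ b d := rfl

theorem smul_pair (c : ℂ) (a b : L2 N k) : c • pair a b = pair (c • a) (c • b) := rfl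

theorem add_pair (a b c d : L2 N k) : pair a b + pair c d = pair (a + c) (b + d) := rfl

theorem pair_inj {a b c d : L2 N k} : pair a b = pair c d ↔ a = c ∧ b = d :=
  ⟨fun h => ⟨congrArg (fun p : Pairs N k => p.fst) h, congrArg (fun p : Pairs N k => p.snd) h⟩,
    fun h => by rw [h.1, h.2]⟩

theorem dense_linOp_domain (β : ℝ) (N : ℕ+) (k : Modulus) :
    Dense ((linOp β N k).domain : Set (Pairs N k)) := by
  have h := (dense_Hper_two N k).prod (dense_Hper_two N k)
  have h2 := h.preimage (WithLp.homeomorphProd 2 (L2 N k) (L2 N k)).isOpenMap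
  exact h2

/-- The adjoint swaps and transposes the entries: `(u, v) ↦ c (-L₊ v, L₋ u)`. The equivalence also
identifies its domain as `H² × H²`, which follows from the self-adjointness of `L₋` and `L₊`. -/
theorem adjOp_apply_eq {β : ℝ} (hβ : β < 0) {u v w₁ w₂ : L2 N k} :
    (∃ h : pair u v ∈ (adjOp β N k).domain, adjOp β N k ⟨pair u v, h⟩ = pair w₁ w₂) ↔
      ∃ (hu : u ∈ Hper N k 2) (hv : v ∈ Hper N k 2),
        w₁ = -(scale β N k : ℂ) • Lplus N k ⟨v, hv⟩ ∧
        w₂ = (scale β N k : ℂ) • Lminus N k ⟨u, hu⟩ := by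
  have hc : (scale β N k : ℂ) ≠ 0 := Complex.ofReal_ne_zero.2 (scale_pos hβ N k).ne'
  have hdense := dense_linOp_domain β N k
  set c : ℂ := (scale β N k : ℂ) with hc_def
  have hcc : conj c = c := Complex.conj_ofReal _
  constructor
  · rintro ⟨h, hw⟩
    have key : ∀ (f g : Hper N k 2), inner ℂ w₁ (f : L2 N k) + inner ℂ w₂ (g : L2 N k)
        = c * (inner ℂ u (Lminus N k g) - inner ℂ v (Lplus N k f)) := by
      intro f g
      have h1 := LinearPMap.adjoint_isFormalAdjoint hdense ⟨pair u v, h⟩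
        ⟨pair f g, pair_mem_HperPairs f.2 g.2⟩
      have h2 : (linOp β N k).adjoint ⟨pair u v, h⟩ = pair w₁ w₂ := hw
      rw [h2, linOp_apply β f.2 g.2, inner_pair, smul_pair, inner_pair, inner_smul_right, inner_smul_right,
        inner_neg_right] at h1
      rw [h1]
      ring
    -- Test pairs `(g, 0)` isolate the weak equation for `v`; below, `(0, g)` isolates that for `u`.
    obtain ⟨hv, hv'⟩ := schrodingerOp_eq_of_inner (N := N) (k := k) 6 (f := v)
      (w := -c⁻¹ • w₁) fun g => by
        have h1 := key g 0
        rw [map_zero, inner_zero_right, Submodule.coe_zero, inner_zero_right] at h1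
        change _ = inner ℂ v (Lplus N k g)
        rw [inner_smul_left, map_neg, map_inv₀, hcc]
        rw [add_zero] at h1
        rw [h1]
        field_simp
        ring
    obtain ⟨hu, hu'⟩ := schrodingerOp_eq_of_inner (N := N) (k := k) 2 (f := u)
      (w := c⁻¹ • w₂) fun g => by
        have h1 := key 0 g
        rw [map_zero, inner_zero_right, Submodule.coe_zero, inner_zero_right, zero_add] at h1
        change _ = inner ℂ u (Lminus N k g)
        rw [inner_smul_left, map_inv₀, hcc, h1]
        field_simp
        ring
    refine ⟨hu, hv, ?_, ?_⟩
    · change _ = -c • schrodingerOp N k 6 ⟨v, hv⟩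
      rw [hv', smul_smul, neg_mul_neg, mul_inv_cancel₀ hc, one_smul]
    · change _ = c • schrodingerOp N k 2 ⟨u, hu⟩
      rw [hu', smul_smul, mul_inv_cancel₀ hc, one_smul]
  · rintro ⟨hu, hv, rfl, rfl⟩
    have key : ∀ x : (linOp β N k).domain,
        inner ℂ (pair (-c • Lplus N k ⟨v, hv⟩) (c • Lminus N k ⟨u, hu⟩)) (x : Pairs N k)
          = inner ℂ (pair u v) (linOp β N k x) := by
      rintro ⟨x, hx⟩
      have h1 := linOp_apply β hx.1 hx.2
      have h2 := inner_schrodingerOp_left 2 ⟨u, hu⟩ ⟨_, hx.2⟩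
      have h3 := inner_schrodingerOp_left 6 ⟨v, hv⟩ ⟨_, hx.1⟩
      have h4 : linOp β N k ⟨x, hx⟩ = _ := h1
      rw [h4, smul_pair, inner_pair, inner_smul_right, inner_smul_right, inner_neg_right]
      change inner ℂ _ x.fst + inner ℂ _ x.snd = _
      change inner ℂ (-c • schrodingerOp N k 6 ⟨v, hv⟩) x.fst
        + inner ℂ (c • schrodingerOp N k 2 ⟨u, hu⟩) x.snd
        = c * inner ℂ u (schrodingerOp N k 2 ⟨x.snd, hx.2⟩)
          + c * -inner ℂ v (schrodingerOp N k 6 ⟨x.fst, hx.1⟩)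
      rw [inner_smul_left, inner_smul_left, map_neg, hcc]
      have h2' : inner ℂ (schrodingerOp N k 2 ⟨u, hu⟩) x.snd
        = inner ℂ u (schrodingerOp N k 2 ⟨x.snd, hx.2⟩) := h2
      have h3' : inner ℂ (schrodingerOp N k 6 ⟨v, hv⟩) x.fst
        = inner ℂ v (schrodingerOp N k 6 ⟨x.fst, hx.1⟩) := h3
      rw [h2', h3']
      ring
    have hmem : pair u v ∈ (linOp β N k).adjoint.domain :=
      LinearPMap.mem_adjoint_domain_of_exists _ ⟨_, key⟩
    exact ⟨hmem, LinearPMap.adjoint_apply_eq hdense ⟨_, hmem⟩ key⟩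

/-! ### Generalized kernels -/

theorem mem_kerPow_succ {V : Type*} [AddCommGroup V] [Module ℂ V] (A : V →ₗ.[ℂ] V) (m : ℕ) (v : V) :
    v ∈ kerPow A (m + 1) ↔ ∃ h : v ∈ A.domain, A ⟨v, h⟩ ∈ kerPow A m := by
  constructor
  · rintro ⟨⟨x, hx⟩, h, rfl⟩
    exact ⟨hx, h⟩
  · rintro ⟨h, h'⟩
    exact ⟨⟨v, h⟩, h', rfl⟩

theorem pair_mem_kerPow_succ {β : ℝ} (hβ : β < 0) (m : ℕ) (u v : L2 N k) :
    pair u v ∈ kerPow (adjOp β N k) (m + 1) ↔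
      ∃ (hu : u ∈ Hper N k 2) (hv : v ∈ Hper N k 2),
        pair (-(scale β N k : ℂ) • Lplus N k ⟨v, hv⟩) ((scale β N k : ℂ) • Lminus N k ⟨u, hu⟩)
          ∈ kerPow (adjOp β N k) m := by
  rw [mem_kerPow_succ]
  constructor
  · rintro ⟨h, h'⟩
    obtain ⟨hu, hv, e1, e2⟩ := (adjOp_apply_eq hβ).1
      ⟨h, (rfl : _ = pair (adjOp β N k ⟨pair u v, h⟩).fst (adjOp β N k ⟨pair u v, h⟩).snd)⟩
    refine ⟨hu, hv, ?_⟩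
    rw [← e1, ← e2]
    exact h'
  · rintro ⟨hu, hv, h⟩
    obtain ⟨h', e⟩ := (adjOp_apply_eq hβ).2 ⟨hu, hv, rfl, rfl⟩
    exact ⟨h', e ▸ h⟩

theorem pair_mem_kerPow_one {β : ℝ} (hβ : β < 0) (u v : L2 N k) :
    pair u v ∈ kerPow (adjOp β N k) 1 ↔
      ∃ a b : ℂ, u = a • dnL2 N k ∧ v = b • snCnL2 N k := by
  have hc : (scale β N k : ℂ) ≠ 0 := Complex.ofReal_ne_zero.2 (scale_pos hβ N k).ne'
  have h0 : ∀ p q : L2 N k, pair p q ∈ kerPow (adjOp β N k) 0 ↔ p = 0 ∧ q = 0 := fun p q =>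
    (Submodule.mem_bot ℂ).trans (pair_inj (c := 0) (d := 0))
  rw [pair_mem_kerPow_succ hβ]
  constructor
  · rintro ⟨hu, hv, h⟩
    rw [h0, smul_eq_zero, smul_eq_zero] at h
    obtain ⟨a, ha⟩ := exists_smul_of_Lminus_eq_zero ⟨u, hu⟩ (h.2.resolve_left hc)
    obtain ⟨b, hb⟩ := exists_smul_of_Lplus_eq_zero ⟨v, hv⟩ (h.1.resolve_left (neg_ne_zero.2 hc))
    exact ⟨a, b, ha, hb⟩
  · rintro ⟨a, b, rfl, rfl⟩
    refine ⟨Submodule.smul_mem _ _ (dnL2_mem N k), Submodule.smul_mem _ _ (snCnL2_mem N k), ?_⟩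
    have e1 := map_smul (Lminus N k) a ⟨dnL2 N k, dnL2_mem N k⟩
    have e2 := map_smul (Lplus N k) b ⟨snCnL2 N k, snCnL2_mem N k⟩
    rw [Lminus_dnL2, smul_zero] at e1
    rw [Lplus_snCnL2, smul_zero] at e2
    rw [h0]
    exact ⟨(congrArg _ e2).trans (smul_zero _), (congrArg _ e1).trans (smul_zero _)⟩

/-! ### The second and third powers of the adjoint. -/

theorem minusConst_ne_zero (k : Modulus) : ((2 * ellE k * -(k : ℝ) ^ 2 : ℝ) : ℂ) ≠ 0 :=
  Complex.ofReal_ne_zero.2 (mul_ne_zero (mul_pos two_pos (ellE_pos k)).ne'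
    (neg_ne_zero.2 (pow_ne_zero 2 k.2.1.ne')))

theorem Lminus_combination (a c : ℂ) (h : a • dnL2 N k + c • phiL2 N k ∈ Hper N k 2) :
    Lminus N k ⟨a • dnL2 N k + c • phiL2 N k, h⟩
      = (c * ((2 * ellE k * -(k : ℝ) ^ 2 : ℝ) : ℂ)) • snCnL2 N k := by
  have e : (⟨a • dnL2 N k + c • phiL2 N k, h⟩ : Hper N k 2)
    = a • ⟨dnL2 N k, dnL2_mem N k⟩ + c • ⟨phiL2 N k, phiL2_mem N k⟩ := rfl
  rw [e, map_add, map_smul, map_smul, Lminus_dnL2, Lminus_phiL2, smul_zero, zero_add, smul_smul]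

theorem Lplus_combination (b d : ℂ) (h : b • snCnL2 N k + d • varphiL2 N k ∈ Hper N k 2) :
    Lplus N k ⟨b • snCnL2 N k + d • varphiL2 N k, h⟩
      = (d * (plusConst k : ℂ)) • dnL2 N k := by
  have e : (⟨b • snCnL2 N k + d • varphiL2 N k, h⟩ : Hper N k 2)
    = b • ⟨snCnL2 N k, snCnL2_mem N k⟩ + d • ⟨varphiL2 N k, varphiL2_mem N k⟩ := rfl
  rw [e, map_add, map_smul, map_smul, Lplus_snCnL2, Lplus_varphiL2, smul_zero, zero_add,
    smul_smul]

/-- Subtracting the right multiple of the particular solution `φ` leaves an element of the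
one-dimensional kernel. -/
theorem exists_of_Lminus_eq_smul (f : Hper N k 2) {b : ℂ} (hf : Lminus N k f = b • snCnL2 N k) :
    ∃ a c : ℂ, (f : L2 N k) = a • dnL2 N k + c • phiL2 N k := by
  set t : ℂ := ((2 * ellE k * -(k : ℝ) ^ 2 : ℝ) : ℂ) with ht
  have ht0 : t ≠ 0 := minusConst_ne_zero k
  obtain ⟨a, ha⟩ := exists_smul_of_Lminus_eq_zero
    (f - (b / t) • ⟨phiL2 N k, phiL2_mem N k⟩) (by
      rw [map_sub, map_smul, hf, Lminus_phiL2, ← ht, smul_smul, div_mul_cancel₀ _ ht0, sub_self])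
  exact ⟨a, b / t, sub_eq_iff_eq_add.1 ha⟩

theorem exists_of_Lplus_eq_smul (f : Hper N k 2) {a : ℂ} (hf : Lplus N k f = a • dnL2 N k) :
    ∃ b d : ℂ, (f : L2 N k) = b • snCnL2 N k + d • varphiL2 N k := by
  set t : ℂ := (plusConst k : ℂ) with ht
  have ht0 : t ≠ 0 := Complex.ofReal_ne_zero.2 (plusConst_ne_zero k)
  obtain ⟨b, hb⟩ := exists_smul_of_Lplus_eq_zero
    (f - (a / t) • ⟨varphiL2 N k, varphiL2_mem N k⟩) (by
      rw [map_sub, map_smul, hf, Lplus_varphiL2, ← ht, smul_smul, div_mul_cancel₀ _ ht0, sub_self])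
  exact ⟨b, a / t, sub_eq_iff_eq_add.1 hb⟩

theorem pair_mem_kerPow_two {β : ℝ} (hβ : β < 0) (u v : L2 N k) :
    pair u v ∈ kerPow (adjOp β N k) 2 ↔
      ∃ a b c d : ℂ, u = a • dnL2 N k + c • phiL2 N k ∧
        v = b • snCnL2 N k + d • varphiL2 N k := by
  have hc : (scale β N k : ℂ) ≠ 0 := Complex.ofReal_ne_zero.2 (scale_pos hβ N k).ne'
  rw [pair_mem_kerPow_succ hβ]
  constructor
  · rintro ⟨hu, hv, h⟩
    obtain ⟨a, b, h1, h2⟩ := (pair_mem_kerPow_one hβ _ _).1 h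
    rw [← eq_inv_smul_iff₀ (neg_ne_zero.2 hc), smul_smul] at h1
    rw [← eq_inv_smul_iff₀ hc, smul_smul] at h2
    obtain ⟨a, c, h3⟩ := exists_of_Lminus_eq_smul _ h2
    obtain ⟨b, d, h4⟩ := exists_of_Lplus_eq_smul _ h1
    exact ⟨a, b, c, d, h3, h4⟩
  · rintro ⟨a, b, c, d, rfl, rfl⟩
    refine ⟨add_mem (Submodule.smul_mem _ _ (dnL2_mem N k))
      (Submodule.smul_mem _ _ (phiL2_mem N k)), add_mem (Submodule.smul_mem _ _ (snCnL2_mem N k))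
      (Submodule.smul_mem _ _ (varphiL2_mem N k)), (pair_mem_kerPow_one hβ _ _).2 ?_⟩
    rw [Lminus_combination, Lplus_combination]
    exact ⟨_, _, smul_smul _ _ _, smul_smul _ _ _⟩

/-- The solvability condition fails: `φ` is not orthogonal to `ker L₊`, nor `ϕ` to `ker L₋`, so
neither can occur in an image under the adjoint. -/
theorem kerPow_three_le {β : ℝ} (hβ : β < 0) :
    kerPow (adjOp β N k) 3 ≤ kerPow (adjOp β N k) 2 := by
  have hc : (scale β N k : ℂ) ≠ 0 := Complex.ofReal_ne_zero.2 (scale_pos hβ N k).ne'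
  intro p hp
  change pair p.fst p.snd ∈ _ at hp
  change pair p.fst p.snd ∈ _
  obtain ⟨hu, hv, h⟩ := (pair_mem_kerPow_succ hβ 2 _ _).1 hp
  refine (pair_mem_kerPow_succ hβ 1 _ _).2 ⟨hu, hv, (pair_mem_kerPow_one hβ _ _).2 ?_⟩
  obtain ⟨a, b, c, d, h1, h2⟩ := (pair_mem_kerPow_two hβ _ _).1 h
  -- Pairing with `sn cn` kills the range of `L₊` and the `dn` term, leaving the coefficient of `φ`
  -- times a nonzero number; pairing with `dn` does the same for `ϕ`.
  have e1 := congrArg (inner ℂ (snCnL2 N k)) h1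
  rw [inner_smul_right, inner_snCn_Lplus, inner_add_right, inner_smul_right, inner_smul_right,
    inner_snCn_dn, mul_zero, mul_zero, zero_add] at e1
  have hc0 := (mul_eq_zero.1 e1.symm).resolve_right (inner_snCn_phi_ne_zero N k)
  have e2 := congrArg (inner ℂ (dnL2 N k)) h2
  rw [inner_smul_right, inner_dn_Lminus, inner_add_right, inner_smul_right, inner_smul_right,
    inner_dn_snCn, mul_zero, mul_zero, zero_add] at e2
  have hd0 := (mul_eq_zero.1 e2.symm).resolve_right (inner_dn_varphi_ne_zero N k)
  refine ⟨a, b, ?_, ?_⟩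
  · rw [h1, hc0, zero_smul, add_zero]
  · rw [h2, hd0, zero_smul, add_zero]

/-- Once the kernels of two successive powers agree, the generalized kernel is reached. -/
theorem genKer_eq_of_kerPow_succ_le {V : Type*} [AddCommGroup V] [Module ℂ V] (A : V →ₗ.[ℂ] V)
    {m : ℕ} (hm : 1 ≤ m) (h : kerPow A (m + 1) ≤ kerPow A m) : genKer A = kerPow A m := by
  have hmono := monotone_nat_of_le_succ (kerPow_le_succ A)
  have hle : ∀ n, kerPow A n ≤ kerPow A m := by
    intro n
    induction n with
    | zero => exact bot_le
    | succ n ih => exact (Submodule.map_mono (Submodule.comap_mono ih)).trans h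
  ext v
  constructor
  · intro hv
    obtain ⟨n, _, hv⟩ := Set.mem_iUnion₂.1 hv
    exact hle n hv
  · intro hv
    exact Set.mem_iUnion₂.2 ⟨m, hm, hv⟩

theorem mem_span_pairs (p : Pairs N k) :
    p ∈ Submodule.span ℂ ({pair (dnL2 N k) 0, pair 0 (snCnL2 N k), pair (phiL2 N k) 0,
      pair 0 (varphiL2 N k)} : Set (Pairs N k)) ↔
      ∃ a b c d : ℂ, p.fst = a • dnL2 N k + c • phiL2 N k ∧
        p.snd = b • snCnL2 N k + d • varphiL2 N k := by
  have e : ∀ a b c d : ℂ, a • pair (dnL2 N k) 0 + (b • pair 0 (snCnL2 N k)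
      + (c • pair (phiL2 N k) 0 + d • pair 0 (varphiL2 N k)))
      = pair (a • dnL2 N k + c • phiL2 N k) (b • snCnL2 N k + d • varphiL2 N k) := by
    intro a b c d
    simp only [smul_pair, add_pair, smul_zero, zero_add, add_zero]
  constructor
  · intro h
    obtain ⟨a, x, hx, rfl⟩ := Submodule.mem_span_insert.1 h
    obtain ⟨b, y, hy, rfl⟩ := Submodule.mem_span_insert.1 hx
    obtain ⟨c, z, hz, rfl⟩ := Submodule.mem_span_insert.1 hy
    obtain ⟨d, rfl⟩ := Submodule.mem_span_singleton.1 hz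
    rw [e]
    exact ⟨a, b, c, d, rfl, rfl⟩
  · rintro ⟨a, b, c, d, h1, h2⟩
    have hp : p = pair p.fst p.snd := rfl
    rw [hp, h1, h2, ← e]
    exact Submodule.mem_span_insert.2 ⟨a, _, Submodule.mem_span_insert.2 ⟨b, _,
      Submodule.mem_span_insert.2 ⟨c, _, Submodule.mem_span_singleton.2 ⟨d, rfl⟩, rfl⟩, rfl⟩, rfl⟩

theorem kerPow_two_eq_span {β : ℝ} (hβ : β < 0) (N : ℕ+) (k : Modulus) :
    kerPow (adjOp β N k) 2 =
      Submodule.span ℂ {pair (dnL2 N k) 0, pair 0 (snCnL2 N k), pair (phiL2 N k) 0,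
        pair 0 (varphiL2 N k)} := by
  ext p
  rw [mem_span_pairs]
  exact pair_mem_kerPow_two hβ p.fst p.snd

end Adjoint

end DnWave

-- For the last claim it suffices to test against the four spanning vectors. The inner product here
-- is conjugate-linear in its first argument and carries the factor `1/(2NK)`; neither affects
-- orthogonality.
open DnWave in
theorem proposition2 (β : ℝ) (hβ : β < 0) (N : ℕ+) (k : Modulus) :
    kerPow (adjOp β N k) 2 =
        Submodule.span ℂ {pair (dnL2 N k) 0, pair 0 (snCnL2 N k), pair (phiL2 N k) 0,
          pair 0 (varphiL2 N k)} ∧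
      genKer (adjOp β N k) = kerPow (adjOp β N k) 2 ∧
      ∀ f ∈ Hper N k 1, ∀ g ∈ Hper N k 1,
        inner ℂ (dnL2 N k) f = 0 → inner ℂ (phiL2 N k) f = 0 →
        inner ℂ (snCnL2 N k) g = 0 → inner ℂ (varphiL2 N k) g = 0 →
        pair f g ∈ spaceM β N k := by
  have hgen := genKer_eq_of_kerPow_succ_le (adjOp β N k) one_le_two (kerPow_three_le hβ)
  refine ⟨kerPow_two_eq_span hβ N k, hgen, fun f hf g hg h1 h2 h3 h4 => ⟨⟨hf, hg⟩, ?_⟩⟩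
  refine (Submodule.mem_orthogonal _ _).2 fun p hp => ?_
  rw [hgen] at hp
  obtain ⟨a, b, c, d, e1, e2⟩ := (pair_mem_kerPow_two hβ p.fst p.snd).1 hp
  change inner ℂ (pair p.fst p.snd) (pair f g) = 0
  rw [inner_pair, e1, e2]
  simp only [inner_add_left, inner_smul_left, h1, h2, h3, h4, mul_zero, add_zero]
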